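/- **Definitions.** Let $E=(E^0,E^1,r,s)$ be an arbitrary directed graph: $E^0$, $E^1$ are sets (with the discrete topology) and $r,s\colon E^1\to E^0$ are maps. The graph algebra $C^*(E)$ is the universal $C^*$-algebra generated by mutually orthogonal projections $\{p_v\}_{v\in E^0}$ and partial isometries $\{s_e\}_{e\in E^1}$ with orthogonal ranges such that $s_e^*s_e=p_{r(e)}$ and $s_es_e^*\le p_{s(e)}$ for $e\in E^1$, and $p_v=\sum_{e\in s^{-1}(v)}s_es_e^*$ whenever $0<|s^{-1}(v)|<\infty$. A $C^*$-correspondence over a $C^*$-algebra $A$ is a right Hilbert $A$-module $X$ with a $*$-homomorphism $\varphi_X\colon A\to\mathcal L(X)$ into the adjointable operators. Let $\mathcal K(X)$ be the closed linear span of the operators $\theta_{\xi,\eta}(\zeta)=\xi\langle\eta,\zeta\rangle$, and put $J_X=\varphi_X^{-1}(\mathcal K(X))\cap(\ker\varphi_X)^{\perp}$, where $I^\perp=\{a\in A: ab=0 \text{ for all } b\in I\}$. A representation of $X$ on a $C^*$-algebra $B$ is a pair $(\pi,t)$ of a $*$-homomorphism $\pi\colon A\to B$ and a linear map $t\colon X\to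 B$ with $t(\xi)^*t(\eta)=\pi(\langle\xi,\eta\rangle)$ and $\pi(a)t(\xi)=t(\varphi_X(a)\xi)$; it induces $\psi_t\colon\mathcal K(X)\to B$ with $\psi_t(\theta_{\xi,\eta})=t(\xi)t(\eta)^*$. It satisfies Condition $(*)$ if $\pi(a)=\psi_t(\varphi_X(a))$ for all $a\in J_X$. The $C^*$-algebra $\mathcal O_X$ is generated by the images of $\pi_X$ and $t_X$, where $(\pi_X,t_X)$ is the universal representation of $X$ satisfying Condition $(*)$. The graph correspondence $X(E)$ over $C_0(E^0)$ is the completion of $C_c(E^1)$ with respect to $\|\xi\|=\|\langle\xi,\xi\rangle\|^{1/2}$, with the operations determined on $C_c(E^1)$ by $\langle\xi,\eta\rangle(v)=\sum_{e\in r^{-1}(v)}\overline{\xi(e)}\eta(e)$, $(\xi f)(e)=\xi(e)f(r(e))$ and $(\varphi_{X(E)}(f)\xi)(e)=f(s(e))\xi(e)$, for $f\in C_0(E^0)$. **Proposition.** For every directed graph $E$ one has $J_{X(E)}=C_0(\{v\in E^0: 0<|s^{-1}(v)|<\infty\})$, and the graph algebra $C^*(E)$ is isomorphic to $\mathcal O_{X(E)}$,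 by a $*$-isomorphism that sends $p_v$ to $\pi_{X(E)}(\delta_v)$ for $v\in E^0$ and $s_e$ to $t_{X(E)}(\delta_e)$ for $e\in E^1$, where $\delta_v\in C_0(E^0)$ and $\delta_e\in C_c(E^1)$ are the point masses. -/

import Mathlib

open scoped ENNReal ZeroAtInfty ComplexConjugate

universe u v w

noncomputable section

/-- A right Hilbert `A`-module: a Banach space `X` with a right action `ξ a = ract a ξ` of the
C⋆-algebra `A` and an `A`-valued inner product `ip`, linear in the second variable. An element of
a C⋆-algebra is positive iff it is of the form `b⋆ b`. -/
class HilbertCStarModule (A : Type u) (X : Type v) [NonUnitalCStarAlgebra A]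
    [NormedAddCommGroup X] [NormedSpace ℂ X] [CompleteSpace X] where
  ract : A →ₗ[ℂ] X →ₗ[ℂ] X
  ract_mul : ∀ (a b : A) (ξ : X), ract (a * b) ξ = ract b (ract a ξ)
  ip : X → X → A
  ip_add_right : ∀ ξ η ζ : X, ip ξ (η + ζ) = ip ξ η + ip ξ ζ
  ip_smul_right : ∀ (c : ℂ) (ξ η : X), ip ξ (c • η) = c • ip ξ η
  ip_ract_right : ∀ (a : A) (ξ η : X), ip ξ (ract a η) = ip ξ η * a
  star_ip : ∀ ξ η : X, star (ip η ξ) = ip ξ η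
  ip_self_nonneg : ∀ ξ : X, ∃ b : A, ip ξ ξ = star b * b
  norm_eq_sqrt : ∀ ξ : X, ‖ξ‖ = √‖ip ξ ξ‖

/-- A C⋆-correspondence over `A`: a right Hilbert `A`-module `X` with a ⋆-homomorphism `φ` from
`A` to the adjointable operators on `X`. That every `φ a` is adjointable and that `φ` preserves the
involution is `ip_φ`: the adjoint of `φ a` is `φ (a⋆)`. -/
class CStarCorrespondence (A : Type u) (X : Type v) [NonUnitalCStarAlgebra A]
    [NormedAddCommGroup X] [NormedSpace ℂ X] [CompleteSpace X] extends
    HilbertCStarModule A X where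
  φ : A →ₙₐ[ℂ] (X →L[ℂ] X)
  ip_φ : ∀ (a : A) (ξ η : X), ip (φ a ξ) η = ip ξ (φ (star a) η)

namespace HilbertCStarModule

variable {A : Type u} {X : Type v} [NonUnitalCStarAlgebra A]
  [NormedAddCommGroup X] [NormedSpace ℂ X] [CompleteSpace X] [HilbertCStarModule A X]

lemma norm_sq (ξ : X) : ‖ξ‖ ^ 2 = ‖(ip ξ ξ : A)‖ := by
  rw [norm_eq_sqrt (A := A), Real.sq_sqrt (norm_nonneg _)]

lemma ip_self_eq_zero (ξ : X) : (ip ξ ξ : A) = 0 ↔ ξ = 0 := by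
  rw [← norm_eq_zero, ← norm_sq]; simp

lemma norm_ip_le (ξ η : X) : ‖(ip ξ η : A)‖ ≤ ‖ξ‖ * ‖η‖ := by
  let : PartialOrder Aᵐᵒᵖ := CStarAlgebra.spectralOrder _
  have : StarOrderedRing Aᵐᵒᵖ := CStarAlgebra.spectralOrderedRing _
  let : SMul Aᵐᵒᵖ X := ⟨fun a ξ => ract a.unop ξ⟩
  let : CStarModule Aᵐᵒᵖ X :=
    { inner := fun ξ η => MulOpposite.op (ip ξ η)
      inner_add_right := by intro x y z; simp [ip_add_right]
      inner_self_nonneg := by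
        intro x
        obtain ⟨b, hb⟩ := ip_self_nonneg (A := A) x
        rw [hb, MulOpposite.op_mul, MulOpposite.op_star]
        exact mul_star_self_nonneg _
      inner_self := by intro x; simp [ip_self_eq_zero]
      inner_op_smul_right := by
        intro a x y
        change MulOpposite.op (ip x (ract a.unop y)) = _
        rw [ip_ract_right]; simp
      inner_smul_right_complex := by intro z x y; simp [ip_smul_right]
      star_inner := by intro x y; rw [← MulOpposite.op_star, star_ip]
      norm_eq_sqrt_norm_inner_self := by intro x; exact norm_eq_sqrt x }
  exact CStarModule.norm_inner_le (A := Aᵐᵒᵖ) X (x := ξ) (y := η)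

lemma ip_ract_left (a : A) (ξ η : X) : (ip (ract a ξ) η : A) = star a * ip ξ η := by
  rw [← star_ip, ip_ract_right, star_mul, star_ip]

lemma norm_ract_le (a : A) (ξ : X) : ‖ract a ξ‖ ≤ ‖ξ‖ * ‖a‖ := by
  refine (sq_le_sq₀ (norm_nonneg _) (by positivity)).mp ?_
  rw [norm_sq (A := A), ip_ract_left, ip_ract_right]
  calc ‖star a * (ip ξ ξ * a)‖ ≤ ‖star a‖ * (‖(ip ξ ξ : A)‖ * ‖a‖) :=
        (norm_mul_le _ _).trans (by gcongr; exact norm_mul_le _ _)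
    _ = (‖ξ‖ * ‖a‖) ^ 2 := by rw [← norm_sq, norm_star]; ring

variable (A)

/-- The operator `θ_{ξ,η} ζ = ξ ⟨η, ζ⟩`. -/
def theta (ξ η : X) : X →L[ℂ] X :=
  LinearMap.mkContinuous
    { toFun := fun ζ => ract (ip η ζ : A) ξ
      map_add' := fun a b => by rw [ip_add_right, map_add, LinearMap.add_apply]
      map_smul' := fun c a => by
        rw [ip_smul_right, map_smul, LinearMap.smul_apply, RingHom.id_apply] }
    (‖ξ‖ * ‖η‖) (fun ζ => by
      refine (norm_ract_le (ip η ζ : A) ξ).trans ?_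
      rw [mul_assoc]
      gcongr
      exact norm_ip_le η ζ)

lemma theta_apply (ξ η ζ : X) : theta A ξ η ζ = ract (ip η ζ : A) ξ := rfl

variable (X)

/-- `K(X)`, the closed linear span of the operators `θ_{ξ,η}`. (The adjointable operators form a
norm-closed subalgebra of the bounded operators, so the closure may be taken in the latter.) -/
def compacts : Submodule ℂ (X →L[ℂ] X) :=
  (Submodule.span ℂ {T | ∃ ξ η : X, T = theta A ξ η}).topologicalClosure

variable {X}

lemma theta_mem_compacts (ξ η : X) : theta A ξ η ∈ compacts A X :=
  Submodule.le_topologicalClosure _ (Submodule.subset_span ⟨ξ, η, rfl⟩)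

variable {A}

lemma ip_add_left (ξ η ζ : X) : (ip (ξ + η) ζ : A) = ip ξ ζ + ip η ζ := by
  rw [← star_ip, ip_add_right, star_add, star_ip, star_ip]

lemma ip_theta (ξ η ζ ω : X) : (ip (theta A ξ η ζ) ω : A) = ip ζ (theta A η ξ ω) := by
  rw [theta_apply, theta_apply, ip_ract_left, ip_ract_right, star_ip]

variable (A) in
/-- The inner product with a fixed first vector, as a linear map. -/
def ipRight (ξ : X) : X →ₗ[ℂ] A where
  toFun := ip ξ
  map_add' := ip_add_right ξ
  map_smul' c η := ip_smul_right c ξ η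

variable (A) in
/-- The inner product with a fixed second vector, as an additive map. -/
def ipLeft (η : X) : X →+ A :=
  AddMonoidHom.mk' (fun ξ => ip ξ η) (fun a b => ip_add_left a b η)

lemma ip_sum_theta {ι : Type*} (s : Finset ι) (x y : ι → X) (ζ ω : X) :
    (ip ((∑ i ∈ s, theta A (x i) (y i)) ζ) ω : A) = ip ζ ((∑ i ∈ s, theta A (y i) (x i)) ω) := by
  have h1 := map_sum (ipLeft A ω) (fun i => theta A (x i) (y i) ζ) s
  have h2 := map_sum (ipRight A ζ) (fun i => theta A (y i) (x i) ω) s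
  rw [sum_apply, sum_apply]
  refine h1.trans (Eq.trans ?_ h2.symm)
  exact Finset.sum_congr rfl fun i _ => ip_theta _ _ _ _

lemma norm_sum_theta_swap_le {ι : Type*} (s : Finset ι) (x y : ι → X) :
    ‖∑ i ∈ s, theta A (y i) (x i)‖ ≤ ‖∑ i ∈ s, theta A (x i) (y i)‖ := by
  refine ContinuousLinearMap.opNorm_le_bound _ (norm_nonneg _) fun ω => ?_
  set S := ∑ i ∈ s, theta A (y i) (x i) with hS
  set T := ∑ i ∈ s, theta A (x i) (y i) with hT
  by_cases h0 : ‖S ω‖ = 0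
  · rw [h0]; positivity
  have hpos : 0 < ‖S ω‖ := lt_of_le_of_ne (norm_nonneg _) (Ne.symm h0)
  refine le_of_mul_le_mul_right ?_ hpos
  calc ‖S ω‖ * ‖S ω‖ = ‖(ip (S ω) (S ω) : A)‖ := by rw [← norm_sq, sq]
    _ = ‖(ip (T (S ω)) ω : A)‖ := by rw [hT, ip_sum_theta s x y (S ω) ω]
    _ ≤ ‖T (S ω)‖ * ‖ω‖ := norm_ip_le _ _
    _ ≤ ‖T‖ * ‖S ω‖ * ‖ω‖ := by gcongr; exact T.le_opNorm _
    _ = ‖T‖ * ‖ω‖ * ‖S ω‖ := by ring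

end HilbertCStarModule

open HilbertCStarModule CStarCorrespondence

/-- The ideal `J_X = φ⁻¹(K(X)) ∩ (ker φ)^⊥`. -/
def idealJ (A : Type u) (X : Type v) [NonUnitalCStarAlgebra A]
    [NormedAddCommGroup X] [NormedSpace ℂ X] [CompleteSpace X] [CStarCorrespondence A X] : Set A :=
  {a | (φ a : X →L[ℂ] X) ∈ compacts A X ∧ ∀ b : A, (φ b : X →L[ℂ] X) = 0 → a * b = 0}

/-- A representation `(π, t)` of the C⋆-correspondence `X` over `A` on the C⋆-algebra `B`. -/
structure CorrRep (A : Type u) (X : Type v) (B : Type w) [NonUnitalCStarAlgebra A]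
    [NormedAddCommGroup X] [NormedSpace ℂ X] [CompleteSpace X] [CStarCorrespondence A X]
    [NonUnitalCStarAlgebra B] where
  π : A →⋆ₙₐ[ℂ] B
  t : X →ₗ[ℂ] B
  star_t_mul_t : ∀ ξ η : X, star (t ξ) * t η = π (ip ξ η)
  π_mul_t : ∀ (a : A) (ξ : X), π a * t ξ = t (φ a ξ)

namespace CorrRep

variable {A : Type u} {X : Type v} {B : Type w} [NonUnitalCStarAlgebra A]
  [NormedAddCommGroup X] [NormedSpace ℂ X] [CompleteSpace X] [CStarCorrespondence A X]
  [NonUnitalCStarAlgebra B] (ρ : CorrRep A X B)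

lemma norm_π_le (a : A) : ‖ρ.π a‖ ≤ ‖a‖ := NonUnitalStarAlgHom.norm_apply_le ρ.π a

lemma norm_t_le (ξ : X) : ‖ρ.t ξ‖ ≤ ‖ξ‖ := by
  refine (sq_le_sq₀ (norm_nonneg _) (by positivity)).mp ?_
  rw [norm_sq (A := A) ξ, sq, ← CStarRing.norm_star_mul_self, ρ.star_t_mul_t]
  exact ρ.norm_π_le _

lemma t_ract (a : A) (ξ : X) : ρ.t (ract a ξ) = ρ.t ξ * ρ.π a := by
  rw [← sub_eq_zero, ← CStarRing.star_mul_self_eq_zero_iff]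
  have h1 : ∀ η : X, star (ρ.t η) * (ρ.t ξ * ρ.π a) = star (ρ.t η) * ρ.t (ract a ξ) := fun η => by
    rw [← mul_assoc, ρ.star_t_mul_t, ρ.star_t_mul_t, ip_ract_right, map_mul]
  rw [star_sub, star_mul, sub_mul, mul_sub, mul_sub, h1, mul_assoc, mul_assoc, h1]
  simp

lemma mul_t_theta (ξ η ζ : X) : ρ.t ξ * star (ρ.t η) * ρ.t ζ = ρ.t (theta A ξ η ζ) := by
  rw [theta_apply, t_ract, ← ρ.star_t_mul_t, mul_assoc]

lemma norm_pow_le {ι : Type*} (s : Finset ι) (n : ℕ) : ∀ x y : ι → X,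
    ‖∑ i ∈ s, ρ.t (x i) * star (ρ.t (y i))‖ ^ (2 ^ n) ≤
      ‖∑ i ∈ s, theta A (x i) (y i)‖ ^ (2 ^ n - 1) * ∑ i ∈ s, ‖x i‖ * ‖y i‖ := by
  induction n with
  | zero =>
    intro x y
    simp only [pow_zero, pow_one, Nat.sub_self, one_mul]
    refine (norm_sum_le _ _).trans (Finset.sum_le_sum fun i _ => ?_)
    refine (norm_mul_le _ _).trans ?_
    rw [norm_star]
    gcongr <;> exact ρ.norm_t_le _
  | succ n ih =>
    intro x y
    set b := ∑ i ∈ s, ρ.t (x i) * star (ρ.t (y i)) with hb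
    set k := ∑ i ∈ s, theta A (x i) (y i) with hk
    have hbt : ∀ ζ, b * ρ.t ζ = ρ.t (k ζ) := by
      intro ζ
      rw [hb, hk, Finset.sum_mul, sum_apply, map_sum]
      exact Finset.sum_congr rfl fun i _ => ρ.mul_t_theta _ _ _
    have hbb : b * star b = ∑ i ∈ s, ρ.t (k (y i)) * star (ρ.t (x i)) := by
      conv_lhs => rw [hb, star_sum, ← hb, Finset.mul_sum]
      refine Finset.sum_congr rfl fun i _ => ?_
      rw [star_mul, star_star, ← mul_assoc, hbt]
    have hkk : ∑ i ∈ s, theta A (k (y i)) (x i) = k * ∑ i ∈ s, theta A (y i) (x i) := by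
      rw [Finset.mul_sum]
      refine Finset.sum_congr rfl fun i _ => ?_
      ext ζ
      simp only [mul_apply_eq_comp, hk, sum_apply, theta_apply,
        ip_ract_right, ract_mul, map_sum]
    have h1 := ih (fun i => k (y i)) x
    rw [← hbb, hkk, CStarRing.norm_self_mul_star] at h1
    have h2 : ‖k * ∑ i ∈ s, theta A (y i) (x i)‖ ≤ ‖k‖ * ‖k‖ :=
      (norm_mul_le _ _).trans (by gcongr; exact norm_sum_theta_swap_le s x y)
    have h3 : ∑ i ∈ s, ‖k (y i)‖ * ‖x i‖ ≤ ‖k‖ * ∑ i ∈ s, ‖x i‖ * ‖y i‖ := by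
      rw [Finset.mul_sum]
      refine Finset.sum_le_sum fun i _ => ?_
      calc ‖k (y i)‖ * ‖x i‖ ≤ ‖k‖ * ‖y i‖ * ‖x i‖ := by gcongr; exact k.le_opNorm _
        _ = _ := by ring
    have hexp : 2 ^ (n + 1) - 1 = 2 * (2 ^ n - 1) + 1 := by
      have := Nat.one_le_two_pow (n := n)
      rw [pow_succ]; omega
    calc ‖b‖ ^ 2 ^ (n + 1) = (‖b‖ * ‖b‖) ^ 2 ^ n := by rw [← sq, ← pow_mul, pow_succ, mul_comm]
      _ ≤ _ := h1
      _ ≤ (‖k‖ * ‖k‖) ^ (2 ^ n - 1) * (‖k‖ * ∑ i ∈ s, ‖x i‖ * ‖y i‖) := by gcongr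
      _ = ‖k‖ ^ (2 ^ (n + 1) - 1) * ∑ i ∈ s, ‖x i‖ * ‖y i‖ := by
        rw [hexp, pow_succ, pow_mul, sq]; ring

lemma norm_sum_le_norm_sum_theta {ι : Type*} (s : Finset ι) (x y : ι → X) :
    ‖∑ i ∈ s, ρ.t (x i) * star (ρ.t (y i))‖ ≤ ‖∑ i ∈ s, theta A (x i) (y i)‖ := by
  set b := ‖∑ i ∈ s, ρ.t (x i) * star (ρ.t (y i))‖
  set k := ‖∑ i ∈ s, theta A (x i) (y i)‖ with hk
  set D := ∑ i ∈ s, ‖x i‖ * ‖y i‖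
  have h : ∀ n : ℕ, b ^ (2 ^ n) ≤ k ^ (2 ^ n - 1) * D := fun n => ρ.norm_pow_le s n x y
  by_contra! hlt
  have hk0 : 0 ≤ k := norm_nonneg _
  rcases hk0.eq_or_lt with h0 | hpos
  · have := h 1
    rw [← h0] at this hlt
    norm_num at this
    exact hlt.ne' this
  · have hr : 1 < b / k := (one_lt_div hpos).mpr hlt
    obtain ⟨m, hm⟩ := pow_unbounded_of_one_lt (D / k) hr
    have h2 : (b / k) ^ m ≤ (b / k) ^ (2 ^ m) :=
      pow_le_pow_right₀ hr.le (Nat.lt_two_pow_self).le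
    have h3 : (b / k) ^ (2 ^ m) ≤ D / k := by
      rw [div_pow, div_le_div_iff₀ (by positivity) hpos]
      calc b ^ 2 ^ m * k ≤ k ^ (2 ^ m - 1) * D * k := by gcongr; exact h m
        _ = D * k ^ (2 ^ m - 1 + 1) := by ring
        _ = D * k ^ 2 ^ m := by rw [Nat.sub_add_cancel Nat.one_le_two_pow]
    linarith

instance : IsBoundedSMul ℂ (compacts A X) where
  dist_smul_pair' c x y := dist_smul_pair c (x : X →L[ℂ] X) (y : X →L[ℂ] X)
  dist_pair_smul' c d x := dist_pair_smul c d (x : X →L[ℂ] X)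

variable (A X) in
/-- Finite formal linear combinations of pairs `(ξ, η)`, mapped to the corresponding linear
combinations of the operators `θ_{ξ,η}`. -/
def thetaComb : (X × X →₀ ℂ) →ₗ[ℂ] compacts A X :=
  Finsupp.linearCombination ℂ fun p => ⟨theta A p.1 p.2, theta_mem_compacts A p.1 p.2⟩

/-- Finite formal linear combinations of pairs `(ξ, η)`, mapped to the corresponding linear
combinations of the elements `t(ξ) t(η)⋆`. -/
def tComb : (X × X →₀ ℂ) →ₗ[ℂ] B :=
  Finsupp.linearCombination ℂ fun p => ρ.t p.1 * star (ρ.t p.2)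

/-- The map `ψ_t : K(X) → B`, the continuous linear extension of `θ_{ξ,η} ↦ t(ξ) t(η)⋆`. -/
def ψ : compacts A X →L[ℂ] B := LinearMap.extendOfNorm ρ.tComb (thetaComb A X)

lemma theta_smul (c : ℂ) (ξ η : X) : theta A (c • ξ) η = c • theta A ξ η := by
  ext ζ; simp [theta_apply]

lemma norm_tComb_le (x : X × X →₀ ℂ) : ‖ρ.tComb x‖ ≤ 1 * ‖thetaComb A X x‖ := by
  have h := ρ.norm_sum_le_norm_sum_theta x.support (fun p => x p • p.1) (fun p => p.2)
  rw [one_mul, Submodule.coe_norm]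
  simpa [tComb, thetaComb, Finsupp.linearCombination_apply, Finsupp.sum, theta_smul, smul_mul_assoc]
    using h

lemma denseRange_thetaComb : DenseRange (thetaComb A X) := by
  intro T
  have hT : (T : X →L[ℂ] X) ∈ closure
      ((Submodule.span ℂ {T | ∃ ξ η : X, T = theta A ξ η} : Submodule ℂ (X →L[ℂ] X)) : Set _) :=
    T.2
  rw [closure_subtype]
  refine closure_mono ?_ hT
  intro S hS
  have : Submodule.span ℂ {T | ∃ ξ η : X, T = theta A ξ η} ≤
      (LinearMap.range (thetaComb A X)).map (compacts A X).subtype := by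
    rw [Submodule.span_le]
    rintro _ ⟨ξ, η, rfl⟩
    exact ⟨_, ⟨Finsupp.single (ξ, η) 1, rfl⟩, by simp [thetaComb]⟩
  obtain ⟨K, ⟨x, rfl⟩, rfl⟩ := this hS
  exact ⟨_, ⟨x, rfl⟩, rfl⟩

lemma ψ_theta (ξ η : X) :
    ρ.ψ ⟨theta A ξ η, theta_mem_compacts A ξ η⟩ = ρ.t ξ * star (ρ.t η) := by
  have h := LinearMap.extendOfNorm_eq (f := ρ.tComb) (e := thetaComb A X)
    denseRange_thetaComb ⟨1, ρ.norm_tComb_le⟩ (Finsupp.single (ξ, η) 1)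
  simpa [ψ, thetaComb, tComb] using h

/-- Condition `(*)`: `π(a) = ψ_t(φ(a))` for all `a ∈ J_X`. -/
def IsCovariant : Prop :=
  ∀ (a : A) (ha : a ∈ idealJ A X), ρ.π a = ρ.ψ ⟨φ a, ha.1⟩

end CorrRep

/-- The C⋆-algebra generated by a subset `S` of a C⋆-algebra `B`. -/
def cstarGen {B : Type w} [NonUnitalCStarAlgebra B] (S : Set B) : NonUnitalStarSubalgebra ℂ B :=
  (NonUnitalStarAlgebra.adjoin ℂ S).topologicalClosure

instance {B : Type w} [NonUnitalCStarAlgebra B] (S : Set B) : IsClosed (cstarGen S : Set B) :=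
  NonUnitalStarSubalgebra.isClosed_topologicalClosure _

lemma subset_cstarGen {B : Type w} [NonUnitalCStarAlgebra B] (S : Set B) :
    S ⊆ (cstarGen S : Set B) := fun _ hx =>
  NonUnitalStarSubalgebra.le_topologicalClosure _ (NonUnitalStarAlgebra.subset_adjoin ℂ S hx)

section OX

variable (A : Type u) (X : Type v) [NonUnitalCStarAlgebra A]
  [NormedAddCommGroup X] [NormedSpace ℂ X] [CompleteSpace X] [CStarCorrespondence A X]

/-- A C⋆-algebra together with a representation of `X` on it that satisfies Condition `(*)`. -/
structure CovRep where
  B : Type (max u v)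
  [inst : NonUnitalCStarAlgebra B]
  ρ : CorrRep A X B
  cov : ρ.IsCovariant

attribute [instance] CovRep.inst

/-- The bounded families, indexed by all covariant representations `(B, π, t)`, of elements of the
respective `B`: the `ℓ^∞`-direct product of all the C⋆-algebras `B`. -/
abbrev covProd : Type (max u v + 1) := lp (fun i : CovRep.{u, v} A X => i.B) ∞

variable {A X}

/-- The family of all `π(a)`. -/
def covProdπ (a : A) : covProd A X :=
  ⟨fun i => i.ρ.π a, memℓp_infty ⟨‖a‖, by rintro _ ⟨i, rfl⟩; exact i.ρ.norm_π_le a⟩⟩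

/-- The family of all `t(ξ)`. -/
def covProdt (ξ : X) : covProd A X :=
  ⟨fun i => i.ρ.t ξ, memℓp_infty ⟨‖ξ‖, by rintro _ ⟨i, rfl⟩; exact i.ρ.norm_t_le ξ⟩⟩

variable (A X)

/-- The C⋆-algebra `O_X`: the C⋆-algebra generated by the universal representation of `X`
satisfying Condition `(*)`, which is realized as the direct product of all such representations.
Every such representation on any C⋆-algebra generates a C⋆-subalgebra which has an isomorphic copy
in `Type (max u v)`, so this range of representations is exhaustive. -/
def algebraO : NonUnitalStarSubalgebra ℂ (covProd A X) :=
  cstarGen (Set.range (covProdπ : A → covProd A X) ∪ Set.range (covProdt : X → covProd A X))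

instance : IsClosed (algebraO A X : Set (covProd A X)) := by
  unfold algebraO; infer_instance

/-- The universal representation `(π_X, t_X)` of `X` on `O_X` satisfying Condition `(*)`. -/
def universalRep : CorrRep A X (algebraO A X) where
  π :=
    { toFun := fun a => ⟨covProdπ a, subset_cstarGen _ (Or.inl ⟨a, rfl⟩)⟩
      map_smul' := fun c a => by ext i; exact map_smul i.ρ.π c a
      map_zero' := by ext i; exact map_zero i.ρ.π
      map_add' := fun a b => by ext i; exact map_add i.ρ.π a b
      map_mul' := fun a b => by ext i; exact map_mul i.ρ.π a b
      map_star' := fun a => by ext i; exact map_star i.ρ.π a }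
  t :=
    { toFun := fun ξ => ⟨covProdt ξ, subset_cstarGen _ (Or.inr ⟨ξ, rfl⟩)⟩
      map_add' := fun a b => by ext i; exact map_add i.ρ.t a b
      map_smul' := fun c a => by ext i; exact map_smul i.ρ.t c a }
  star_t_mul_t ξ η := by ext i; exact i.ρ.star_t_mul_t ξ η
  π_mul_t a ξ := by ext i; exact i.ρ.π_mul_t a ξ

/-- The universal representation satisfies Condition `(*)`. -/
theorem universalRep_isCovariant : (universalRep A X).IsCovariant := by
  intro a ha
  ext i
  change i.ρ.π a = _
  rw [i.cov a ha]
  have key : ∀ T : compacts A X,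
      i.ρ.ψ T = (((universalRep A X).ψ T : algebraO A X) : covProd A X) i := by
    intro T
    have hc : Continuous fun T => (((universalRep A X).ψ T : algebraO A X) : covProd A X) i := by
      have h1 : Continuous fun x : covProd A X => x i := by
        refine (LipschitzWith.of_dist_le_mul (K := 1) fun x y => ?_).continuous
        rw [dist_eq_norm, dist_eq_norm, NNReal.coe_one, one_mul]
        exact lp.norm_apply_le_norm (by simp) (x - y) i
      exact h1.comp (continuous_subtype_val.comp (universalRep A X).ψ.continuous)
    refine CorrRep.denseRange_thetaComb.induction_on
      (p := fun T => i.ρ.ψ T = (((universalRep A X).ψ T : algebraO A X) : covProd A X) i) T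
      (isClosed_eq i.ρ.ψ.continuous hc) fun x => ?_
    induction x using Finsupp.induction_linear with
    | zero => simp
    | add f g hf hg => simp [hf, hg]
    | single p c =>
      have h : CorrRep.thetaComb A X (Finsupp.single p c) =
          c • ⟨theta A p.1 p.2, theta_mem_compacts A p.1 p.2⟩ := by simp [CorrRep.thetaComb]
      rw [h, map_smul, map_smul, CorrRep.ψ_theta, CorrRep.ψ_theta]
      rfl
  exact key _

end OX

/-- A directed graph `(E⁰, E¹, r, s)`. -/
structure DirectedGraph where
  Vertex : Type u
  Edge : Type v
  r : Edge → Vertex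
  s : Edge → Vertex

namespace DirectedGraph

variable (E : DirectedGraph.{u, v})

/-- The set `E⁰` of vertices carries the discrete topology. -/
instance : TopologicalSpace E.Vertex := ⊥

instance : DiscreteTopology E.Vertex := ⟨rfl⟩

/-- `0 < |s⁻¹(v)| < ∞`. -/
def IsRegular (v : E.Vertex) : Prop := (E.s ⁻¹' {v}).Nonempty ∧ (E.s ⁻¹' {v}).Finite

/-! ### The graph algebra -/

/-- Mutually orthogonal projections `p v` and partial isometries `S e` with orthogonal ranges in a
C⋆-algebra `B`, such that `S_e⋆ S_e = p_{r(e)}`, `S_e S_e⋆ ≤ p_{s(e)}` (for projections, `q ≤ p`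
means `p q = q`), and `p_v = ∑_{s(e) = v} S_e S_e⋆` if `0 < |s⁻¹(v)| < ∞`. -/
structure CKFamily (B : Type w) [NonUnitalCStarAlgebra B] where
  p : E.Vertex → B
  S : E.Edge → B
  isStarProjection_p : ∀ v, IsStarProjection (p v)
  p_orthogonal : ∀ v w, v ≠ w → p v * p w = 0
  partialIsometry : ∀ e, S e * star (S e) * S e = S e
  ranges_orthogonal : ∀ e f, e ≠ f → (S e * star (S e)) * (S f * star (S f)) = 0
  star_S_mul_S : ∀ e, star (S e) * S e = p (E.r e)
  S_mul_star_S_le : ∀ e, p (E.s e) * (S e * star (S e)) = S e * star (S e)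
  p_eq_sum : ∀ (v : E.Vertex) (h : E.IsRegular v), p v = ∑ e ∈ h.2.toFinset, S e * star (S e)

variable {E} in
lemma _root_.IsStarProjection.norm_le_one' {B : Type w} [NonUnitalCStarAlgebra B] {p : B}
    (hp : IsStarProjection p) : ‖p‖ ≤ 1 := by
  have h : ‖p‖ * ‖p‖ = ‖p‖ := by
    rw [← CStarRing.norm_star_mul_self, hp.isSelfAdjoint.star_eq, hp.isIdempotentElem.eq]
  nlinarith [norm_nonneg p]

variable {E} in
lemma CKFamily.norm_p_le {B : Type w} [NonUnitalCStarAlgebra B] (F : E.CKFamily B)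
    (v : E.Vertex) : ‖F.p v‖ ≤ 1 := (F.isStarProjection_p v).norm_le_one'

variable {E} in
lemma CKFamily.norm_S_le {B : Type w} [NonUnitalCStarAlgebra B] (F : E.CKFamily B)
    (e : E.Edge) : ‖F.S e‖ ≤ 1 := by
  have h : ‖F.S e‖ * ‖F.S e‖ ≤ 1 := by
    rw [← CStarRing.norm_star_mul_self, F.star_S_mul_S]
    exact F.norm_p_le _
  nlinarith [norm_nonneg (F.S e)]

/-- A C⋆-algebra together with a Cuntz–Krieger `E`-family in it. -/
structure CKRep where
  B : Type (max u v)
  [inst : NonUnitalCStarAlgebra B]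
  F : E.CKFamily B

attribute [instance] CKRep.inst

/-- The `ℓ^∞`-direct product of the C⋆-algebras `B` over all Cuntz–Krieger `E`-families. -/
abbrev ckProd : Type (max u v + 1) := lp (fun i : CKRep.{u, v} E => i.B) ∞

variable {E}

/-- The family of all `p v`. -/
def ckProdP (v : E.Vertex) : E.ckProd :=
  ⟨fun i => i.F.p v, memℓp_infty ⟨1, by rintro _ ⟨i, rfl⟩; exact i.F.norm_p_le v⟩⟩

/-- The family of all `S e`. -/
def ckProdS (e : E.Edge) : E.ckProd :=
  ⟨fun i => i.F.S e, memℓp_infty ⟨1, by rintro _ ⟨i, rfl⟩; exact i.F.norm_S_le e⟩⟩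

variable (E)

/-- The graph algebra `C⋆(E)`: the universal C⋆-algebra generated by a Cuntz–Krieger `E`-family,
realized as the C⋆-algebra generated by the direct product of all Cuntz–Krieger `E`-families.
Every such family in any C⋆-algebra generates a C⋆-subalgebra which has an isomorphic copy in
`Type (max u v)`, so this range of families is exhaustive. -/
def graphAlgebra : NonUnitalStarSubalgebra ℂ E.ckProd :=
  cstarGen (Set.range (ckProdP : E.Vertex → E.ckProd) ∪ Set.range (ckProdS : E.Edge → E.ckProd))

instance : IsClosed (E.graphAlgebra : Set E.ckProd) := by
  unfold graphAlgebra; infer_instance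

/-- The coordinate of an element of `C⋆(E)` at a Cuntz–Krieger `E`-family. -/
def graphAlgebraEval (i : CKRep.{u, v} E) : E.graphAlgebra →+ i.B :=
  AddMonoidHom.mk' (fun x => (x : E.ckProd) i) fun _ _ => rfl

/-- The generating projections `p_v` of `C⋆(E)`. -/
def genP (v : E.Vertex) : E.graphAlgebra := ⟨ckProdP v, subset_cstarGen _ (Or.inl ⟨v, rfl⟩)⟩

/-- The generating partial isometries `s_e` of `C⋆(E)`. -/
def genS (e : E.Edge) : E.graphAlgebra := ⟨ckProdS e, subset_cstarGen _ (Or.inr ⟨e, rfl⟩)⟩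

/-- The universal Cuntz–Krieger `E`-family `(p_v), (s_e)`, which generates `C⋆(E)`. -/
def universalFamily : E.CKFamily E.graphAlgebra where
  p := E.genP
  S := E.genS
  isStarProjection_p v :=
    ⟨by ext i; exact (i.F.isStarProjection_p v).isIdempotentElem,
      by ext i; exact (i.F.isStarProjection_p v).isSelfAdjoint⟩
  p_orthogonal v w h := by ext i; exact i.F.p_orthogonal v w h
  partialIsometry e := by ext i; exact i.F.partialIsometry e
  ranges_orthogonal e f h := by ext i; exact i.F.ranges_orthogonal e f h
  star_S_mul_S e := by ext i; exact i.F.star_S_mul_S e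
  S_mul_star_S_le e := by ext i; exact i.F.S_mul_star_S_le e
  p_eq_sum v h := by
    ext i
    exact (i.F.p_eq_sum v h).trans (map_sum (E.graphAlgebraEval i)
      (fun e => E.genS e * star (E.genS e)) h.2.toFinset).symm

/-! ### The graph correspondence -/

/-- A finitely supported function on `E⁰`, as an element of `C₀(E⁰)`. -/
def c0OfFinite (f : E.Vertex → ℂ) (hf : (Function.support f).Finite) : C₀(E.Vertex, ℂ) where
  toFun := f
  continuous_toFun := continuous_of_discreteTopology
  zero_at_infty' := by
    rw [Filter.cocompact_eq_cofinite]
    refine Filter.Tendsto.congr' ?_ tendsto_const_nhds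
    filter_upwards [hf.compl_mem_cofinite] with v hv
    simpa using! (show f v = 0 by simpa using hv).symm

open scoped Classical in
/-- The point mass `δ_v` in `C₀(E⁰)`. -/
def vertexDelta (v : E.Vertex) : C₀(E.Vertex, ℂ) :=
  E.c0OfFinite (Pi.single v 1) ((Set.finite_singleton v).subset (by
    intro w hw
    by_contra h
    exact hw (Pi.single_eq_of_ne (by simpa using h) _)))

/-- `C_c(E¹)`: the finitely supported functions on the discrete set `E¹`. -/
def Cc : Type v := E.Edge →₀ ℂ

instance : AddCommGroup E.Cc := inferInstanceAs (AddCommGroup (E.Edge →₀ ℂ))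

instance : Module ℂ E.Cc := inferInstanceAs (Module ℂ (E.Edge →₀ ℂ))

instance : FunLike E.Cc E.Edge ℂ := inferInstanceAs (FunLike (E.Edge →₀ ℂ) E.Edge ℂ)

variable {E}

@[ext] lemma Cc.ext {ξ η : E.Cc} (h : ∀ e, ξ e = η e) : ξ = η := Finsupp.ext h

@[simp] lemma Cc.add_apply (ξ η : E.Cc) (e : E.Edge) : (ξ + η) e = ξ e + η e := rfl

@[simp] lemma Cc.smul_apply (c : ℂ) (ξ : E.Cc) (e : E.Edge) : (c • ξ) e = c * ξ e := rfl

@[simp] lemma Cc.zero_apply (e : E.Edge) : (0 : E.Cc) e = 0 := rfl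

/-- The support of an element of `C_c(E¹)`. -/
def Cc.support (ξ : E.Cc) : Finset E.Edge := Finsupp.support ξ

lemma Cc.mem_support (ξ : E.Cc) (e : E.Edge) : e ∈ ξ.support ↔ ξ e ≠ 0 := Finsupp.mem_support_iff

/-- The point mass `δ_e` in `C_c(E¹)`. -/
def Cc.single (e : E.Edge) : E.Cc := Finsupp.single e (1 : ℂ)

/-- Pointwise multiplication of an element of `C_c(E¹)` by a function on `E¹`. -/
def Cc.mulFun (g : E.Edge → ℂ) : E.Cc →ₗ[ℂ] E.Cc where
  toFun ξ := (Finsupp.onFinset ξ.support (fun e => ξ e * g e) (fun e he => by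
    rw [Cc.mem_support]; exact left_ne_zero_of_mul he) : E.Edge →₀ ℂ)
  map_add' ξ η := by ext e; exact add_mul _ _ _
  map_smul' c ξ := by ext e; exact mul_assoc _ _ _

@[simp] lemma Cc.mulFun_apply (g : E.Edge → ℂ) (ξ : E.Cc) (e : E.Edge) :
    Cc.mulFun g ξ e = ξ e * g e := rfl

open scoped Classical in
/-- The inner product `⟨ξ, η⟩(v) = ∑_{r(e) = v} conj ξ(e) η(e)` on `C_c(E¹)`. -/
def Cc.ip (ξ η : E.Cc) : C₀(E.Vertex, ℂ) :=
  E.c0OfFinite (fun v => ∑ e ∈ ξ.support with E.r e = v, conj (ξ e) * η e) (by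
    refine (ξ.support.finite_toSet.image E.r).subset fun v hv => ?_
    obtain ⟨e, he, -⟩ := Finset.exists_ne_zero_of_sum_ne_zero hv
    rw [Finset.mem_filter] at he
    exact ⟨e, he.1, he.2⟩)

open scoped Classical in
lemma Cc.ip_apply (ξ η : E.Cc) (v : E.Vertex) (s : Finset E.Edge) (hs : ξ.support ⊆ s) :
    Cc.ip ξ η v = ∑ e ∈ s with E.r e = v, conj (ξ e) * η e := by
  change ∑ e ∈ ξ.support with E.r e = v, conj (ξ e) * η e = _
  refine Finset.sum_subset (Finset.filter_subset_filter _ hs) fun e he he' => ?_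
  have : ξ e = 0 := by
    by_contra h
    exact he' (Finset.mem_filter.mpr ⟨(ξ.mem_support e).mpr h, (Finset.mem_filter.mp he).2⟩)
  simp [this]

open scoped Classical in
lemma Cc.ip_apply' (ξ η : E.Cc) (v : E.Vertex) :
    Cc.ip ξ η v = ∑ e ∈ ξ.support with E.r e = v, conj (ξ e) * η e := rfl

/-- The right action `(ξ f)(e) = ξ(e) f(r(e))`. -/
instance : SMul C₀(E.Vertex, ℂ) E.Cc := ⟨fun f ξ => Cc.mulFun (fun e => f (E.r e)) ξ⟩

lemma Cc.ip_self_apply (ξ : E.Cc) (v : E.Vertex) :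
    ∃ c : ℝ, 0 ≤ c ∧ Cc.ip ξ ξ v = (c : ℂ) := by
  classical
  refine ⟨∑ e ∈ ξ.support with E.r e = v, ‖ξ e‖ ^ 2,
    Finset.sum_nonneg fun e _ => sq_nonneg _, ?_⟩
  rw [Cc.ip_apply']
  push_cast
  exact Finset.sum_congr rfl fun e _ => Complex.conj_mul' _

lemma c0_exists_star_mul_self (f : C₀(E.Vertex, ℂ))
    (hf : ∀ v, ∃ c : ℝ, 0 ≤ c ∧ f v = (c : ℂ)) : ∃ b : C₀(E.Vertex, ℂ), f = star b * b := by
  refine ⟨⟨⟨fun v => ((√ ‖f v‖ : ℝ) : ℂ), continuous_of_discreteTopology⟩, ?_⟩, ?_⟩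
  · have h1 := (zero_at_infty f).norm
    rw [norm_zero] at h1
    have h2 := (Real.continuous_sqrt.tendsto 0).comp h1
    rw [Real.sqrt_zero] at h2
    have h3 := (Complex.continuous_ofReal.tendsto 0).comp h2
    simpa using! h3
  · ext v
    obtain ⟨c, hc, hv⟩ := hf v
    change f v = star ((√ ‖f v‖ : ℝ) : ℂ) * ((√ ‖f v‖ : ℝ) : ℂ)
    rw [hv, Complex.norm_real, Real.norm_of_nonneg hc]
    simp only [Complex.star_def, Complex.conj_ofReal, ← Complex.ofReal_mul, Real.mul_self_sqrt hc]

lemma Cc.ip_self_eq_zero (ξ : E.Cc) : Cc.ip ξ ξ = 0 ↔ ξ = 0 := by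
  classical
  constructor
  · intro h
    ext e
    by_contra he
    have h1 : Cc.ip ξ ξ (E.r e) = 0 := by rw [h]; rfl
    rw [Cc.ip_apply'] at h1
    have h2 : ∑ e' ∈ ξ.support with E.r e' = E.r e, ‖ξ e'‖ ^ 2 = 0 := by
      have : ((∑ e' ∈ ξ.support with E.r e' = E.r e, ‖ξ e'‖ ^ 2 : ℝ) : ℂ) = 0 := by
        rw [← h1]
        push_cast
        exact Finset.sum_congr rfl fun e _ => (Complex.conj_mul' _).symm
      exact_mod_cast this
    rw [Finset.sum_eq_zero_iff_of_nonneg fun _ _ => sq_nonneg _] at h2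
    have := h2 e (Finset.mem_filter.mpr ⟨(ξ.mem_support e).mpr he, rfl⟩)
    exact he (by simpa using this)
  · rintro rfl
    ext v
    rw [Cc.ip_apply']
    simp

/-- The norm `‖ξ‖ = ‖⟨ξ, ξ⟩‖^{1/2}`. -/
instance : Norm E.Cc := ⟨fun ξ => √‖Cc.ip ξ ξ‖⟩

lemma Cc.norm_def (ξ : E.Cc) : ‖ξ‖ = √‖Cc.ip ξ ξ‖ := rfl

lemma Cc.ip_add_right (ξ η ζ : E.Cc) : Cc.ip ξ (η + ζ) = Cc.ip ξ η + Cc.ip ξ ζ := by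
  classical
  ext v
  simp only [ZeroAtInftyContinuousMap.add_apply, Cc.ip_apply', Cc.add_apply, mul_add,
    Finset.sum_add_distrib]

lemma Cc.ip_smul_right (c : ℂ) (ξ η : E.Cc) : Cc.ip ξ (c • η) = c • Cc.ip ξ η := by
  classical
  ext v
  simp only [ZeroAtInftyContinuousMap.smul_apply, Cc.ip_apply', Cc.smul_apply, smul_eq_mul,
    Finset.mul_sum]
  exact Finset.sum_congr rfl fun e _ => by ring

lemma Cc.ip_act_right (f : C₀(E.Vertex, ℂ)) (ξ η : E.Cc) :
    Cc.ip ξ (Cc.mulFun (fun e => f (E.r e)) η) = Cc.ip ξ η * f := by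
  classical
  ext v
  simp only [ZeroAtInftyContinuousMap.mul_apply, Cc.ip_apply', Cc.mulFun_apply, Finset.sum_mul]
  refine Finset.sum_congr rfl fun e he => ?_
  rw [(Finset.mem_filter.mp he).2, mul_assoc]

lemma Cc.star_ip (ξ η : E.Cc) : star (Cc.ip η ξ) = Cc.ip ξ η := by
  classical
  ext v
  rw [ZeroAtInftyContinuousMap.star_apply,
    Cc.ip_apply η ξ v (ξ.support ∪ η.support) Finset.subset_union_right,
    Cc.ip_apply ξ η v (ξ.support ∪ η.support) Finset.subset_union_left, star_sum]
  refine Finset.sum_congr rfl fun e _ => ?_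
  simp [mul_comm]

lemma Cc.ip_mulFun_left (g : E.Edge → ℂ) (ξ η : E.Cc) :
    Cc.ip (Cc.mulFun g ξ) η = Cc.ip ξ (Cc.mulFun (fun e => conj (g e)) η) := by
  classical
  ext v
  have hs : (Cc.mulFun g ξ).support ⊆ ξ.support := fun e he => by
    rw [Cc.mem_support] at he ⊢
    exact left_ne_zero_of_mul he
  rw [Cc.ip_apply _ η v _ hs, Cc.ip_apply']
  refine Finset.sum_congr rfl fun e _ => ?_
  simp only [Cc.mulFun_apply, map_mul]
  ring

lemma Cc.core_and_cauchySchwarz :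
    NormedSpace.Core ℂ E.Cc ∧ ∀ ξ η : E.Cc, ‖Cc.ip ξ η‖ ≤ ‖ξ‖ * ‖η‖ := by
  let _ : PartialOrder C₀(E.Vertex, ℂ) := CStarAlgebra.spectralOrder _
  have _ : StarOrderedRing C₀(E.Vertex, ℂ) := CStarAlgebra.spectralOrderedRing _
  let _ : CStarModule C₀(E.Vertex, ℂ) E.Cc :=
    { inner := Cc.ip
      inner_add_right := Cc.ip_add_right _ _ _
      inner_self_nonneg := by
        intro ξ
        obtain ⟨b, hb⟩ := c0_exists_star_mul_self _ ξ.ip_self_apply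
        rw [hb]
        exact star_mul_self_nonneg b
      inner_self := Cc.ip_self_eq_zero _
      inner_op_smul_right := by
        intro f ξ η
        rw [mul_comm]
        exact Cc.ip_act_right f ξ η
      inner_smul_right_complex := Cc.ip_smul_right _ _ _
      star_inner := fun ξ η => Cc.star_ip η ξ
      norm_eq_sqrt_norm_inner_self := Cc.norm_def }
  exact ⟨CStarModule.normedSpaceCore C₀(E.Vertex, ℂ),
    fun ξ η => CStarModule.norm_inner_le (A := C₀(E.Vertex, ℂ)) E.Cc (x := ξ) (y := η)⟩

instance : NormedAddCommGroup E.Cc := NormedAddCommGroup.ofCore Cc.core_and_cauchySchwarz.1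

instance : NormedSpace ℂ E.Cc := NormedSpace.ofCore Cc.core_and_cauchySchwarz.1

lemma norm_apply_le_norm (f : C₀(E.Vertex, ℂ)) (v : E.Vertex) : ‖f v‖ ≤ ‖f‖ := by
  rw [← ZeroAtInftyContinuousMap.norm_toBCF_eq_norm]
  exact f.toBCF.norm_coe_le_norm v

lemma c0_norm_le (f : C₀(E.Vertex, ℂ)) {C : ℝ} (hC : 0 ≤ C) (h : ∀ v, ‖f v‖ ≤ C) : ‖f‖ ≤ C := by
  rw [← ZeroAtInftyContinuousMap.norm_toBCF_eq_norm]
  exact (BoundedContinuousFunction.norm_le hC).mpr h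

lemma Cc.norm_mulFun_le (g : E.Edge → ℂ) (C : ℝ) (hC : 0 ≤ C) (hg : ∀ e, ‖g e‖ ≤ C) (ξ : E.Cc) :
    ‖Cc.mulFun g ξ‖ ≤ C * ‖ξ‖ := by
  classical
  have key : ‖Cc.ip (Cc.mulFun g ξ) (Cc.mulFun g ξ)‖ ≤ C ^ 2 * ‖Cc.ip ξ ξ‖ := by
    refine c0_norm_le _ (by positivity) fun v => ?_
    have h1 : Cc.ip ξ ξ v = ((∑ e ∈ ξ.support with E.r e = v, ‖ξ e‖ ^ 2 : ℝ) : ℂ) := by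
      rw [Cc.ip_apply']
      push_cast
      exact Finset.sum_congr rfl fun e _ => Complex.conj_mul' _
    have h2 := norm_apply_le_norm (Cc.ip ξ ξ) v
    rw [h1, Complex.norm_real, Real.norm_of_nonneg (Finset.sum_nonneg fun e _ => sq_nonneg _)] at h2
    refine le_trans ?_ (mul_le_mul_of_nonneg_left h2 (sq_nonneg C))
    rw [Cc.ip_mulFun_left, Cc.ip_apply', Finset.mul_sum]
    refine (norm_sum_le _ _).trans (Finset.sum_le_sum fun e _ => ?_)
    have h3 : ‖g e‖ ^ 2 ≤ C ^ 2 := by gcongr; exact hg e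
    calc ‖conj (ξ e) * Cc.mulFun (fun e => conj (g e)) (Cc.mulFun g ξ) e‖
        = ‖g e‖ ^ 2 * ‖ξ e‖ ^ 2 := by
          simp only [Cc.mulFun_apply, norm_mul, RCLike.norm_conj]; ring
      _ ≤ C ^ 2 * ‖ξ e‖ ^ 2 := by gcongr
  rw [Cc.norm_def, Cc.norm_def]
  calc √‖Cc.ip (Cc.mulFun g ξ) (Cc.mulFun g ξ)‖ ≤ √(C ^ 2 * ‖Cc.ip ξ ξ‖) := Real.sqrt_le_sqrt key
    _ = C * √‖Cc.ip ξ ξ‖ := by rw [Real.sqrt_mul (sq_nonneg C), Real.sqrt_sq hC]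

/-- Pointwise multiplication by `e ↦ f (k e)`, for `f ∈ C₀(E⁰)` and `k : E¹ → E⁰`, as a bounded
operator on `C_c(E¹)`. -/
def Cc.mulL (k : E.Edge → E.Vertex) (f : C₀(E.Vertex, ℂ)) : E.Cc →L[ℂ] E.Cc :=
  (Cc.mulFun fun e => f (k e)).mkContinuous ‖f‖
    (Cc.norm_mulFun_le _ _ (norm_nonneg f) fun e => norm_apply_le_norm f (k e))

@[simp] lemma Cc.mulL_apply (k : E.Edge → E.Vertex) (f : C₀(E.Vertex, ℂ)) (ξ : E.Cc) (e : E.Edge) :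
    Cc.mulL k f ξ e = ξ e * f (k e) := rfl

lemma Cc.ip_add_left (ξ η ζ : E.Cc) : Cc.ip (ξ + η) ζ = Cc.ip ξ ζ + Cc.ip η ζ := by
  rw [← Cc.star_ip, Cc.ip_add_right, star_add, Cc.star_ip, Cc.star_ip]

lemma Cc.ip_smul_left (c : ℂ) (ξ ζ : E.Cc) : Cc.ip (c • ξ) ζ = star c • Cc.ip ξ ζ := by
  rw [← Cc.star_ip, Cc.ip_smul_right, star_smul, Cc.star_ip]

lemma Cc.continuous_ip : Continuous fun p : E.Cc × E.Cc => Cc.ip p.1 p.2 := by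
  let L : E.Cc →ₗ⋆[ℂ] E.Cc →ₗ[ℂ] C₀(E.Vertex, ℂ) :=
    LinearMap.mk₂'ₛₗ (starRingEnd ℂ) (RingHom.id ℂ) Cc.ip Cc.ip_add_left Cc.ip_smul_left
      Cc.ip_add_right Cc.ip_smul_right
  let M : E.Cc →L⋆[ℂ] E.Cc →L[ℂ] C₀(E.Vertex, ℂ) := L.mkContinuous₂ 1 fun ξ η => by
    rw [one_mul]; exact Cc.core_and_cauchySchwarz.2 ξ η
  exact (M.continuous.comp continuous_fst).clm_apply continuous_snd

variable (E)

/-- The completion `X(E)` of `C_c(E¹)` in the norm `‖ξ‖ = ‖⟨ξ, ξ⟩‖^{1/2}`. -/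
abbrev graphModule : Type v := UniformSpace.Completion E.Cc

variable {E}

open UniformSpace

/-- The continuous extension of the inner product of `C_c(E¹)` to `X(E)`. -/
def gip (x y : E.graphModule) : C₀(E.Vertex, ℂ) :=
  (Completion.isDenseInducing_coe.prodMap Completion.isDenseInducing_coe).extend
    (fun p : E.Cc × E.Cc => Cc.ip p.1 p.2) (x, y)

lemma gip_coe (ξ η : E.Cc) : gip (ξ : E.graphModule) (η : E.graphModule) = Cc.ip ξ η :=
  (Completion.isDenseInducing_coe.prodMap Completion.isDenseInducing_coe).extend_eq
    Cc.continuous_ip (ξ, η)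

lemma continuous_extend_biadditive {V W : Type*} [NormedAddCommGroup V] [NormedAddCommGroup W]
    [CompleteSpace W] (β : V →+ V →+ W) (h : Continuous fun p : V × V => β p.1 p.2) :
    Continuous fun p : Completion V × Completion V =>
      (Completion.isDenseInducing_coe.prodMap Completion.isDenseInducing_coe).extend
        (fun p : V × V => β p.1 p.2) (p.1, p.2) :=
  (Completion.isDenseInducing_toCompl V).extend_Z_bilin (Completion.isDenseInducing_toCompl V) h

lemma continuous_gip : Continuous fun p : E.graphModule × E.graphModule => gip p.1 p.2 := by
  let ip' : E.Cc →+ E.Cc →+ C₀(E.Vertex, ℂ) :=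
    AddMonoidHom.mk' (fun ξ => AddMonoidHom.mk' (Cc.ip ξ) (Cc.ip_add_right ξ)) fun ξ η => by
      ext1 ζ; exact Cc.ip_add_left ξ η ζ
  have h : Continuous fun p : E.Cc × E.Cc => ip' p.1 p.2 := Cc.continuous_ip
  exact continuous_extend_biadditive ip' h

lemma Continuous.gip {Y : Type*} [TopologicalSpace Y] {f g : Y → E.graphModule}
    (hf : Continuous f) (hg : Continuous g) : Continuous fun y => gip (f y) (g y) :=
  continuous_gip.comp (hf.prodMk hg)

/-- The continuous extension to `X(E)` of pointwise multiplication by `f ∘ k` on `C_c(E¹)`. -/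
def gmul (k : E.Edge → E.Vertex) (f : C₀(E.Vertex, ℂ)) : E.graphModule →L[ℂ] E.graphModule :=
  (Cc.mulL k f).completion

lemma gmul_coe (k : E.Edge → E.Vertex) (f : C₀(E.Vertex, ℂ)) (ξ : E.Cc) :
    gmul k f (ξ : E.graphModule) = (Cc.mulL k f ξ : E.graphModule) :=
  ContinuousLinearMap.completion_apply_coe _ _

lemma gext {S T : E.graphModule →L[ℂ] E.graphModule} (h : ∀ ξ : E.Cc, S ξ = T ξ) : S = T := by
  ext x
  induction x using Completion.induction_on with
  | hp => exact isClosed_eq S.continuous T.continuous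
  | ih ξ => exact h ξ

lemma gmul_add (k : E.Edge → E.Vertex) (f g : C₀(E.Vertex, ℂ)) :
    gmul k (f + g) = gmul k f + gmul k g := gext fun ξ => by
  rw [add_apply, gmul_coe, gmul_coe, gmul_coe, ← Completion.coe_add]
  congr 1; ext e; exact mul_add _ _ _

lemma gmul_smul (k : E.Edge → E.Vertex) (c : ℂ) (f : C₀(E.Vertex, ℂ)) :
    gmul k (c • f) = c • gmul k f := gext fun ξ => by
  rw [smul_apply, gmul_coe, gmul_coe, ← Completion.coe_smul]
  congr 1; ext e; exact mul_left_comm _ _ _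

lemma gmul_mul (k : E.Edge → E.Vertex) (f g : C₀(E.Vertex, ℂ)) :
    gmul k (f * g) = gmul k f * gmul k g := gext fun ξ => by
  rw [mul_apply_eq_comp, gmul_coe, gmul_coe, gmul_coe]
  congr 1; ext e
  simp only [Cc.mulL_apply, ZeroAtInftyContinuousMap.mul_apply]
  ring

lemma gip_add_right (x y z : E.graphModule) : gip x (y + z) = gip x y + gip x z := by
  induction x, y, z using Completion.induction_on₃ with
  | hp =>
    have h1 : Continuous fun p : E.graphModule × E.graphModule × E.graphModule =>
        gip p.1 (p.2.1 + p.2.2) := Continuous.gip (by fun_prop) (by fun_prop)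
    have h2 : Continuous fun p : E.graphModule × E.graphModule × E.graphModule =>
        gip p.1 p.2.1 := Continuous.gip (by fun_prop) (by fun_prop)
    have h3 : Continuous fun p : E.graphModule × E.graphModule × E.graphModule =>
        gip p.1 p.2.2 := Continuous.gip (by fun_prop) (by fun_prop)
    exact isClosed_eq h1 (h2.add h3)
  | ih ξ η ζ => rw [← Completion.coe_add, gip_coe, gip_coe, gip_coe, Cc.ip_add_right]

lemma gip_smul_right (c : ℂ) (x y : E.graphModule) : gip x (c • y) = c • gip x y := by
  induction x, y using Completion.induction_on₂ with
  | hp =>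
    have h1 : Continuous fun p : E.graphModule × E.graphModule => gip p.1 (c • p.2) :=
      Continuous.gip continuous_fst (continuous_snd.const_smul c)
    exact isClosed_eq h1 ((continuous_const_smul c).comp continuous_gip)
  | ih ξ η => rw [← Completion.coe_smul, gip_coe, gip_coe, Cc.ip_smul_right]

lemma gip_gmul_right (f : C₀(E.Vertex, ℂ)) (x y : E.graphModule) :
    gip x (gmul E.r f y) = gip x y * f := by
  induction x, y using Completion.induction_on₂ with
  | hp =>
    have h1 : Continuous fun p : E.graphModule × E.graphModule => gip p.1 (gmul E.r f p.2) :=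
      Continuous.gip continuous_fst ((gmul E.r f).continuous.comp continuous_snd)
    exact isClosed_eq h1 ((continuous_mul_const f).comp continuous_gip)
  | ih ξ η => rw [gmul_coe, gip_coe, gip_coe]; exact Cc.ip_act_right f ξ η

lemma star_gip (x y : E.graphModule) : star (gip y x) = gip x y := by
  induction x, y using Completion.induction_on₂ with
  | hp =>
    have h1 : Continuous fun p : E.graphModule × E.graphModule => gip p.2 p.1 :=
      Continuous.gip continuous_snd continuous_fst
    exact isClosed_eq (continuous_star.comp h1) continuous_gip
  | ih ξ η => rw [gip_coe, gip_coe, Cc.star_ip]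

lemma gip_self_nonneg (x : E.graphModule) : ∃ b : C₀(E.Vertex, ℂ), gip x x = star b * b := by
  refine c0_exists_star_mul_self _ fun v => ?_
  suffices h : gip x x v ∈ Set.range ((↑) : ℝ → ℂ) ∧ 0 ≤ (gip x x v).re by
    obtain ⟨⟨c, hc⟩, h0⟩ := h
    rw [← hc, Complex.ofReal_re] at h0
    exact ⟨c, h0, hc.symm⟩
  have hev : Continuous fun x : E.graphModule => gip x x v :=
    ((continuous_eval_const (F := BoundedContinuousFunction E.Vertex ℂ) v).comp
      (ZeroAtInftyContinuousMap.isometry_toBCF (α := E.Vertex) (β := ℂ)).continuous).comp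
      (Continuous.gip continuous_id continuous_id)
  induction x using Completion.induction_on with
  | hp =>
    exact (Complex.isometry_ofReal.isClosedEmbedding.isClosed_range.preimage hev).inter
      (isClosed_le continuous_const (Complex.continuous_re.comp hev))
  | ih ξ =>
    rw [gip_coe]
    obtain ⟨c, h0, hc⟩ := ξ.ip_self_apply v
    rw [hc]
    exact ⟨⟨c, rfl⟩, by simpa using h0⟩

lemma gnorm_eq_sqrt (x : E.graphModule) : ‖x‖ = √‖gip x x‖ := by
  induction x using Completion.induction_on with
  | hp =>
    exact isClosed_eq continuous_norm
      (Real.continuous_sqrt.comp (Continuous.gip continuous_id continuous_id).norm)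
  | ih ξ => rw [gip_coe, Completion.norm_coe]; exact Cc.norm_def ξ

lemma gip_gmul_left (f : C₀(E.Vertex, ℂ)) (x y : E.graphModule) :
    gip (gmul E.s f x) y = gip x (gmul E.s (star f) y) := by
  induction x, y using Completion.induction_on₂ with
  | hp =>
    exact isClosed_eq
      (Continuous.gip ((gmul E.s f).continuous.comp continuous_fst) continuous_snd)
      (Continuous.gip continuous_fst ((gmul E.s (star f)).continuous.comp continuous_snd))
  | ih ξ η => rw [gmul_coe, gmul_coe, gip_coe, gip_coe]; exact Cc.ip_mulFun_left _ ξ η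

/-- The graph correspondence `X(E)` over `C₀(E⁰)`: the completion of `C_c(E¹)` with the continuous
extensions of the inner product `⟨ξ, η⟩(v) = ∑_{r(e) = v} conj ξ(e) η(e)`, the right action
`(ξ f)(e) = ξ(e) f(r(e))` and the left action `(φ(f) ξ)(e) = f(s(e)) ξ(e)`. -/
instance graphCorrespondence : CStarCorrespondence C₀(E.Vertex, ℂ) E.graphModule where
  ip := gip
  ract :=
    { toFun := fun f => (gmul E.r f).toLinearMap
      map_add' := fun f g => by rw [gmul_add]; rfl
      map_smul' := fun c f => by rw [gmul_smul]; rfl }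
  ract_mul f g x := by
    change gmul E.r (f * g) x = gmul E.r g (gmul E.r f x)
    rw [mul_comm, gmul_mul]; rfl
  ip_add_right := gip_add_right
  ip_smul_right := gip_smul_right
  ip_ract_right := gip_gmul_right
  star_ip := star_gip
  ip_self_nonneg := gip_self_nonneg
  norm_eq_sqrt := gnorm_eq_sqrt
  φ :=
    { toFun := fun f => gmul E.s f
      map_smul' := fun c f => gmul_smul E.s c f
      map_zero' := by simpa using gmul_smul E.s 0 0
      map_add' := gmul_add E.s
      map_mul' := gmul_mul E.s }
  ip_φ := gip_gmul_left

variable (E)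

/-- The point mass `δ_e` in `C_c(E¹) ⊆ X(E)`. -/
def edgeDelta (e : E.Edge) : E.graphModule := (Cc.single e : E.Cc)

end DirectedGraph

end

noncomputable section

open HilbertCStarModule CStarCorrespondence

namespace DirectedGraph

variable {E : DirectedGraph.{u, v}}

/-! ### Point masses and finite approximation -/

/-! Everything is controlled by point masses. The `δ_v` span a dense subspace of `C₀(E⁰)`, and every
`f` is the norm-convergent sum of the `f(v) δ_v` (`hasSum_vertexDelta`). The `δ_e` are unit vectors
with dense span in `X(E)` that are orthogonal for the inner product, with `⟨δ_e, δ_e⟩ = δ_{r(e)}`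
and `φ(f) δ_e = f(s(e)) δ_e`. Hence bounded linear maps on either space may be compared on point
masses alone.

For `J` (`mem_idealJ_iff`): if `v` emits no edge, then `φ(δ_v) = 0` and orthogonality to `ker φ`
forces `f(v) = 0`. Compact operators send `δ_e` to `0` along the cofinite filter
(`tendsto_compacts_edgeDelta`), so a vertex with `f(v) ≠ 0` emits only finitely many edges.
Conversely, at a regular vertex `φ(δ_v)` is the finite sum of the `θ_{δ_e, δ_e}` with `s(e) = v`
(`φ_vertexDelta`).

For the isomorphism, Cuntz–Krieger families and covariant representations in a fixed `B` correspond
to each other through `p_v = π(δ_v)` and `S_e = t(δ_e)`. From a family, `π` and `t` exist because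
their values on finite combinations are norm-decreasing: contractivity of ⋆-homomorphisms gives this
for `π`, and the C⋆-identity carries it to `t`. The formula for `φ(δ_v)` turns Condition `(*)` at
`δ_v` into the Cuntz–Krieger relation at `v`.

Both universal algebras sit in `ℓ^∞`-products indexed by all families, respectively all covariant
representations, with values in the same universe. Reindexing along the correspondence gives
⋆-homomorphisms between the products in both directions. These match the generators, so they
restrict to mutually inverse maps of the generated subalgebras. -/

lemma vertexDelta_self (v : E.Vertex) : E.vertexDelta v v = 1 := by
  classical
  exact Pi.single_eq_same (M := fun _ => ℂ) v 1

lemma vertexDelta_of_ne {v w : E.Vertex} (h : w ≠ v) : E.vertexDelta v w = 0 := by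
  classical
  exact Pi.single_eq_of_ne (M := fun _ => ℂ) h 1

open scoped Classical in
lemma vertexDelta_apply (v w : E.Vertex) : E.vertexDelta v w = if w = v then 1 else 0 := by
  split_ifs with h
  · rw [h, vertexDelta_self]
  · exact vertexDelta_of_ne h

lemma c0_sum_apply {ι : Type*} (s : Finset ι) (f : ι → C₀(E.Vertex, ℂ)) (w : E.Vertex) :
    (∑ i ∈ s, f i) w = ∑ i ∈ s, f i w := by
  classical
  induction s using Finset.induction_on with
  | empty => rfl
  | insert a s ha ih =>
    rw [Finset.sum_insert ha, Finset.sum_insert ha, ZeroAtInftyContinuousMap.add_apply, ih]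

/-- Every `f ∈ C₀(E⁰)` is the unconditionally convergent sum of the `f(v) δ_v`. -/
lemma hasSum_vertexDelta (f : C₀(E.Vertex, ℂ)) : HasSum (fun v => f v • E.vertexDelta v) f := by
  classical
  rw [HasSum, SummationFilter.unconditional_filter, Metric.tendsto_atTop]
  intro ε hε
  have hf : ∀ᶠ v in Filter.cofinite, ‖f v‖ < ε / 2 := by
    have h := (zero_at_infty f).norm
    rw [norm_zero, Filter.cocompact_eq_cofinite] at h
    exact h.eventually (gt_mem_nhds (half_pos hε))
  -- The finite set is where `|f| ≥ ε/2`. For any larger `s` the error is `0` on `s` and `f` off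
  -- `s`, hence at most `ε/2` in norm.
  refine ⟨(Filter.eventually_cofinite.mp hf).toFinset, fun s hs => ?_⟩
  rw [dist_eq_norm]
  refine lt_of_le_of_lt (c0_norm_le _ (half_pos hε).le fun w => ?_) (half_lt_self hε)
  have h1 : (∑ v ∈ s, f v • E.vertexDelta v) w = if w ∈ s then f w else 0 := by
    rw [c0_sum_apply]
    simp [vertexDelta_apply]
  rw [ZeroAtInftyContinuousMap.sub_apply, h1]
  split_ifs with hw
  · simpa using (half_pos hε).le
  · by_contra h
    refine hw (hs ?_)
    rw [Set.Finite.mem_toFinset]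
    intro h'
    apply h
    simpa using h'.le

lemma vertexDelta_mul_self (v : E.Vertex) :
    E.vertexDelta v * E.vertexDelta v = E.vertexDelta v := by
  classical
  ext w; simp [vertexDelta_apply]

lemma vertexDelta_mul_of_ne {v w : E.Vertex} (h : v ≠ w) :
    E.vertexDelta v * E.vertexDelta w = 0 := by
  classical
  ext x
  simp only [ZeroAtInftyContinuousMap.mul_apply, vertexDelta_apply,
    ZeroAtInftyContinuousMap.zero_apply]
  split_ifs with h1 h2 <;> simp_all

lemma star_vertexDelta (v : E.Vertex) : star (E.vertexDelta v) = E.vertexDelta v := by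
  classical
  ext w
  rw [ZeroAtInftyContinuousMap.star_apply, vertexDelta_apply]
  split_ifs <;> simp

lemma mul_vertexDelta (f : C₀(E.Vertex, ℂ)) (v : E.Vertex) :
    f * E.vertexDelta v = f v • E.vertexDelta v := by
  classical
  ext w
  simp only [ZeroAtInftyContinuousMap.mul_apply, vertexDelta_apply,
    ZeroAtInftyContinuousMap.smul_apply]
  split_ifs with h <;> simp [h]

/-! ### Edge point masses in `X(E)` -/

lemma Cc.single_self (e : E.Edge) : Cc.single e e = 1 := Finsupp.single_eq_same

open scoped Classical in
lemma Cc.single_apply (e f : E.Edge) : Cc.single e f = if f = e then 1 else 0 := by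
  split_ifs with h
  · rw [h, Cc.single_self]
  · exact Finsupp.single_eq_of_ne h

/-- `⟨δ_e, η⟩ = η(e) δ_{r(e)}`. -/
lemma Cc.ip_single_left (e : E.Edge) (η : E.Cc) :
    Cc.ip (Cc.single e) η = η e • E.vertexDelta (E.r e) := by
  classical
  ext w
  rw [Cc.ip_apply _ η w {e} (by
    intro f hf
    rw [Cc.mem_support, Cc.single_apply] at hf
    simpa using hf), Finset.sum_filter, Finset.sum_singleton, Cc.single_self,
    ZeroAtInftyContinuousMap.smul_apply, vertexDelta_apply]
  by_cases h : E.r e = w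
  · simp [h]
  · simp [h, Ne.symm h]

lemma ip_edgeDelta_coe (e : E.Edge) (η : E.Cc) :
    (ip (E.edgeDelta e) (η : E.graphModule) : C₀(E.Vertex, ℂ)) = η e • E.vertexDelta (E.r e) :=
  (gip_coe _ _).trans (Cc.ip_single_left e η)

lemma ip_edgeDelta_self (e : E.Edge) :
    (ip (E.edgeDelta e) (E.edgeDelta e) : C₀(E.Vertex, ℂ)) = E.vertexDelta (E.r e) := by
  refine (ip_edgeDelta_coe e (Cc.single e)).trans ?_
  rw [Cc.single_self, one_smul]

lemma ip_edgeDelta_of_ne {e f : E.Edge} (h : e ≠ f) :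
    (ip (E.edgeDelta e) (E.edgeDelta f) : C₀(E.Vertex, ℂ)) = 0 := by
  classical
  refine (ip_edgeDelta_coe e (Cc.single f)).trans ?_
  rw [Cc.single_apply, if_neg h, zero_smul]

lemma norm_vertexDelta (v : E.Vertex) : ‖E.vertexDelta v‖ = 1 := by
  classical
  refine le_antisymm (c0_norm_le _ zero_le_one fun w => ?_) ?_
  · rw [vertexDelta_apply]; split_ifs <;> simp
  · simpa [vertexDelta_self] using norm_apply_le_norm (E.vertexDelta v) v

lemma norm_edgeDelta (e : E.Edge) : ‖E.edgeDelta e‖ = 1 := by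
  rw [norm_eq_sqrt (A := C₀(E.Vertex, ℂ)), ip_edgeDelta_self, norm_vertexDelta, Real.sqrt_one]

lemma ract_coe (f : C₀(E.Vertex, ℂ)) (ξ : E.Cc) :
    ract f (ξ : E.graphModule) = ((Cc.mulL E.r f ξ : E.Cc) : E.graphModule) := gmul_coe _ _ _

lemma φ_coe (f : C₀(E.Vertex, ℂ)) (ξ : E.Cc) :
    φ f (ξ : E.graphModule) = ((Cc.mulL E.s f ξ : E.Cc) : E.graphModule) := gmul_coe _ _ _

lemma Cc.mulL_single (k : E.Edge → E.Vertex) (f : C₀(E.Vertex, ℂ)) (e : E.Edge) :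
    Cc.mulL k f (Cc.single e) = f (k e) • Cc.single e := by
  classical
  ext g
  rw [Cc.mulL_apply, Cc.smul_apply, Cc.single_apply]
  split_ifs with h <;> simp [h]

lemma ract_edgeDelta (f : C₀(E.Vertex, ℂ)) (e : E.Edge) :
    ract f (E.edgeDelta e) = f (E.r e) • E.edgeDelta e := by
  rw [edgeDelta, ract_coe, Cc.mulL_single, UniformSpace.Completion.coe_smul]

lemma φ_edgeDelta (f : C₀(E.Vertex, ℂ)) (e : E.Edge) :
    φ f (E.edgeDelta e) = f (E.s e) • E.edgeDelta e := by
  rw [edgeDelta, φ_coe, Cc.mulL_single, UniformSpace.Completion.coe_smul]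

/-- Together with density of `C_c(E¹)`, this reduces statements about `X(E)` to the `δ_e`. -/
lemma coe_eq_sum (ξ : E.Cc) :
    (ξ : E.graphModule) = ∑ e ∈ ξ.support, ξ e • E.edgeDelta e := by
  have h : ξ = ∑ e ∈ ξ.support, ξ e • Cc.single e := by
    have h1 := Finsupp.sum_single (α := E.Edge) (M := ℂ) ξ
    conv_lhs => rw [← h1]
    refine Finset.sum_congr rfl fun e _ => ?_
    change _ = ξ e • (Finsupp.single e (1 : ℂ))
    rw [Finsupp.smul_single, smul_eq_mul, mul_one]; rfl
  have h2 := congrArg (UniformSpace.Completion.toComplL (𝕜 := ℂ) (E := E.Cc)) h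
  rw [map_sum] at h2
  refine h2.trans (Finset.sum_congr rfl fun e _ => ?_)
  rw [map_smul]; rfl

/-- Bounded operators that agree on the point masses are equal. -/
lemma clm_ext_edgeDelta {W : Type*} [NormedAddCommGroup W] [NormedSpace ℂ W]
    {S T : E.graphModule →L[ℂ] W} (h : ∀ e, S (E.edgeDelta e) = T (E.edgeDelta e)) : S = T := by
  ext x
  induction x using UniformSpace.Completion.induction_on with
  | hp => exact isClosed_eq S.continuous T.continuous
  | ih ξ => rw [coe_eq_sum, map_sum, map_sum]; simp only [map_smul, h]

/-- Bounded operators that agree on the point masses are equal. -/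
lemma clm_ext_vertexDelta {W : Type*} [NormedAddCommGroup W] [NormedSpace ℂ W]
    {S T : C₀(E.Vertex, ℂ) →L[ℂ] W} (h : ∀ v, S (E.vertexDelta v) = T (E.vertexDelta v)) :
    S = T := by
  ext f
  have h1 := (hasSum_vertexDelta f).mapL S
  have h2 := (hasSum_vertexDelta f).mapL T
  simp only [map_smul, h] at h1 h2
  exact h1.unique h2

/-! ### The ideal `J` -/

/-- Continuity of `φ` is what allows it to be applied termwise to `f = ∑ f(v) δ_v`. -/
lemma norm_φ_le (f : C₀(E.Vertex, ℂ)) : ‖(φ f : E.graphModule →L[ℂ] E.graphModule)‖ ≤ ‖f‖ := by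
  refine ContinuousLinearMap.opNorm_le_bound _ (norm_nonneg f) fun x => ?_
  induction x using UniformSpace.Completion.induction_on with
  | hp =>
    exact isClosed_le (ContinuousLinearMap.continuous _).norm (continuous_const.mul continuous_norm)
  | ih ξ =>
    rw [φ_coe, UniformSpace.Completion.norm_coe, UniformSpace.Completion.norm_coe]
    exact Cc.norm_mulFun_le _ _ (norm_nonneg f) (fun e => norm_apply_le_norm f (E.s e)) ξ

variable (E) in
/-- The left action as a bounded linear map. -/
def φL : C₀(E.Vertex, ℂ) →L[ℂ] (E.graphModule →L[ℂ] E.graphModule) :=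
  LinearMap.mkContinuous
    { toFun := fun f => φ f
      map_add' := fun f g => map_add φ f g
      map_smul' := fun c f => map_smul φ c f } 1 fun f => by rw [one_mul]; exact norm_φ_le f

lemma φL_apply (f : C₀(E.Vertex, ℂ)) : E.φL f = φ f := rfl

/-- `φ(δ_v) = ∑_{s(e) = v} θ_{δ_e, δ_e}` if `v` emits finitely many edges. -/
lemma φ_vertexDelta (v : E.Vertex) (h : (E.s ⁻¹' {v}).Finite) :
    (φ (E.vertexDelta v) : E.graphModule →L[ℂ] E.graphModule) =
      ∑ e ∈ h.toFinset, theta C₀(E.Vertex, ℂ) (E.edgeDelta e) (E.edgeDelta e) := by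
  classical
  refine clm_ext_edgeDelta fun f => ?_
  rw [φ_edgeDelta, sum_apply]
  -- By orthogonality `θ_{δ_e, δ_e}` fixes `δ_e` and annihilates every other point mass.
  have h1 : ∀ e, theta C₀(E.Vertex, ℂ) (E.edgeDelta e) (E.edgeDelta e) (E.edgeDelta f) =
      if e = f then E.edgeDelta f else 0 := fun e => by
    rw [theta_apply]
    split_ifs with hef
    · rw [hef, ip_edgeDelta_self, ract_edgeDelta, vertexDelta_self, one_smul]
    · rw [ip_edgeDelta_of_ne hef, map_zero, LinearMap.zero_apply]
  simp only [h1, Finset.sum_ite_eq', Set.Finite.mem_toFinset, Set.mem_preimage,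
    Set.mem_singleton_iff, vertexDelta_apply]
  split_ifs <;> simp

lemma φ_vertexDelta_mem_compacts (v : E.Vertex) (h : (E.s ⁻¹' {v}).Finite) :
    (φ (E.vertexDelta v) : E.graphModule →L[ℂ] E.graphModule) ∈
      compacts C₀(E.Vertex, ℂ) E.graphModule := by
  rw [φ_vertexDelta v h]
  exact Submodule.sum_mem _ fun e _ => theta_mem_compacts _ _ _

/-- `⟨η, δ_e⟩ → 0` as `e` leaves the finite sets of edges. -/
lemma tendsto_ip_edgeDelta (η : E.graphModule) :
    Filter.Tendsto (fun e => ‖(ip η (E.edgeDelta e) : C₀(E.Vertex, ℂ))‖) Filter.cofinite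
      (nhds 0) := by
  rw [Metric.tendsto_nhds]
  intro ε hε
  obtain ⟨y, hy, hd⟩ : ∃ y ∈ Set.range ((↑) : E.Cc → E.graphModule), dist η y < ε :=
    Metric.mem_closure_iff.mp (UniformSpace.Completion.denseRange_coe (α := E.Cc) η) ε hε
  obtain ⟨ξ, rfl⟩ := hy
  -- Off the finite support of the approximant `ξ` one has `⟨ξ, δ_e⟩ = 0`, so only `η - ξ`
  -- contributes, and Cauchy–Schwarz with `‖δ_e‖ = 1` bounds it by `ε`.
  have hfin : ∀ᶠ e in Filter.cofinite, e ∉ ξ.support := ξ.support.finite_toSet.compl_mem_cofinite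
  filter_upwards [hfin] with e he
  rw [Cc.mem_support, not_not] at he
  have h1 : (ip (ξ : E.graphModule) (E.edgeDelta e) : C₀(E.Vertex, ℂ)) = 0 := by
    rw [← star_ip, ip_edgeDelta_coe, he, zero_smul, star_zero]
  have h2 : (ip η (E.edgeDelta e) : C₀(E.Vertex, ℂ)) = ip (η - ξ) (E.edgeDelta e) := by
    conv_lhs => rw [← sub_add_cancel η ξ, HilbertCStarModule.ip_add_left, h1, add_zero]
  rw [Real.dist_0_eq_abs, abs_of_nonneg (norm_nonneg _), h2]
  refine (norm_ip_le _ _).trans_lt ?_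
  rwa [norm_edgeDelta, mul_one, ← dist_eq_norm]

/-- `T δ_e → 0` for every compact operator `T`. -/
lemma tendsto_compacts_edgeDelta {T : E.graphModule →L[ℂ] E.graphModule}
    (hT : T ∈ compacts C₀(E.Vertex, ℂ) E.graphModule) :
    Filter.Tendsto (fun e => T (E.edgeDelta e)) Filter.cofinite (nhds 0) := by
  have hspan : ∀ S ∈ Submodule.span ℂ {T | ∃ ξ η : E.graphModule, T = theta C₀(E.Vertex, ℂ) ξ η},
      Filter.Tendsto (fun e => S (E.edgeDelta e)) Filter.cofinite (nhds 0) := by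
    intro S hS
    induction hS using Submodule.span_induction with
    | mem S h =>
      obtain ⟨ξ, η, rfl⟩ := h
      -- Here `θ_{ξ,η} δ_e = ξ ⟨η, δ_e⟩`, whose norm is at most `‖ξ‖ ‖⟨η, δ_e⟩‖`.
      refine squeeze_zero_norm (fun e => norm_ract_le (ip η (E.edgeDelta e) : C₀(E.Vertex, ℂ)) ξ) ?_
      simpa using (tendsto_ip_edgeDelta η).const_mul ‖ξ‖
    | zero => simpa using tendsto_const_nhds
    | add S T _ _ hS hT => simpa using hS.add hT
    | smul c S _ hS => simpa using hS.const_smul c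
  rw [Metric.tendsto_nhds]
  intro ε hε
  -- The property survives norm limits because the `δ_e` are unit vectors: `T δ_e` and `S δ_e`
  -- differ by at most `‖T - S‖`, uniformly in `e`.
  obtain ⟨S, hS, hd⟩ := Metric.mem_closure_iff.mp hT (ε / 2) (half_pos hε)
  filter_upwards [Metric.tendsto_nhds.mp (hspan S hS) (ε / 2) (half_pos hε)] with e he
  rw [dist_zero_right] at he ⊢
  rw [dist_eq_norm] at hd
  have h1 : ‖(T - S) (E.edgeDelta e)‖ ≤ ‖T - S‖ := by
    simpa [norm_edgeDelta] using (T - S).le_opNorm (E.edgeDelta e)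
  calc ‖T (E.edgeDelta e)‖ = ‖(T - S) (E.edgeDelta e) + S (E.edgeDelta e)‖ := by simp
    _ ≤ ‖(T - S) (E.edgeDelta e)‖ + ‖S (E.edgeDelta e)‖ := norm_add_le _ _
    _ < ε := by linarith

/-- Membership in `(ker φ)^⊥` excludes sinks, and compactness of `φ(f)` excludes infinite emitters.
Conversely, `φ(f)` is a norm limit of finite combinations of compact operators `φ(δ_v)`, and `φ(b) =
0` makes `b` vanish at every source of an edge, in particular wherever `f` does not. -/
theorem mem_idealJ_iff (f : C₀(E.Vertex, ℂ)) :
    f ∈ idealJ C₀(E.Vertex, ℂ) E.graphModule ↔ ∀ v, f v ≠ 0 → E.IsRegular v := by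
  constructor
  · rintro ⟨hK, hperp⟩ v hv
    refine ⟨?_, ?_⟩
    · by_contra hne
      rw [Set.not_nonempty_iff_eq_empty] at hne
      have h0 : (φ (E.vertexDelta v) : E.graphModule →L[ℂ] E.graphModule) = 0 := by
        refine clm_ext_edgeDelta fun e => ?_
        have he : E.s e ≠ v := fun h => by
          have : e ∈ E.s ⁻¹' {v} := h
          rw [hne] at this
          exact this
        rw [φ_edgeDelta, vertexDelta_of_ne he, zero_smul, zero_apply]
      have h1 := DFunLike.congr_fun (hperp _ h0) v
      rw [ZeroAtInftyContinuousMap.mul_apply, vertexDelta_self, mul_one] at h1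
      exact hv h1
    · have h1 := (tendsto_compacts_edgeDelta hK).norm
      rw [norm_zero] at h1
      -- Only finitely many edges fail `‖φ(f) δ_e‖ < |f(v)|`. Every edge out of `v` fails it, since
      -- there the norm equals `|f(v)|`.
      have h2 := Filter.eventually_cofinite.mp (h1.eventually (gt_mem_nhds (norm_pos_iff.mpr hv)))
      refine h2.subset fun e he => ?_
      have he' : E.s e = v := he
      rw [Set.mem_ofPred_eq, φ_edgeDelta, norm_smul, norm_edgeDelta, mul_one, he']
      exact lt_irrefl _
  · intro hf
    refine ⟨?_, fun b hb => ?_⟩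
    · have h1 := (hasSum_vertexDelta f).mapL E.φL
      refine (Submodule.isClosed_topologicalClosure _).mem_of_tendsto h1
        (Filter.Eventually.of_forall fun s => ?_)
      refine Submodule.sum_mem _ fun v _ => ?_
      rw [map_smul, φL_apply]
      by_cases hv : f v = 0
      · rw [hv, zero_smul]; exact Submodule.zero_mem _
      · exact Submodule.smul_mem _ _ (φ_vertexDelta_mem_compacts v (hf v hv).2)
    · ext v
      rw [ZeroAtInftyContinuousMap.mul_apply, ZeroAtInftyContinuousMap.zero_apply]
      by_cases hv : f v = 0
      · rw [hv, zero_mul]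
      · obtain ⟨e, he⟩ := (hf v hv).1
        have h1 := φ_edgeDelta b e
        rw [hb, zero_apply, eq_comm, smul_eq_zero] at h1
        have hne : E.edgeDelta e ≠ 0 :=
          norm_ne_zero_iff.mp (by rw [norm_edgeDelta]; exact one_ne_zero)
        have he' : E.s e = v := he
        rw [← he', h1.resolve_right hne, mul_zero]

/-! ### Covariant representations from Cuntz–Krieger families -/

namespace CKFamily

variable {B : Type w} [NonUnitalCStarAlgebra B] (F : E.CKFamily B)

lemma star_p (v : E.Vertex) : star (F.p v) = F.p v := (F.isStarProjection_p v).isSelfAdjoint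

lemma p_mul_self (v : E.Vertex) : F.p v * F.p v = F.p v :=
  (F.isStarProjection_p v).isIdempotentElem

open scoped Classical in
lemma p_mul_p (v w : E.Vertex) : F.p v * F.p w = if v = w then F.p v else 0 := by
  split_ifs with h
  · rw [← h, p_mul_self]
  · exact F.p_orthogonal v w h

/-- Writing `S_e⋆ = S_e⋆ (S_e S_e⋆)` and `S_f = (S_f S_f⋆) S_f` puts the product of the two
orthogonal range projections in the middle. -/
lemma star_S_mul_S_of_ne {e f : E.Edge} (h : e ≠ f) : star (F.S e) * F.S f = 0 := by
  have h1 : star (F.S e) = star (F.S e) * (F.S e * star (F.S e)) := by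
    have := congrArg star (F.partialIsometry e)
    simpa [mul_assoc] using this.symm
  rw [h1, ← F.partialIsometry f]
  calc star (F.S e) * (F.S e * star (F.S e)) * (F.S f * star (F.S f) * F.S f)
      = star (F.S e) * (F.S e * star (F.S e) * (F.S f * star (F.S f))) * F.S f := by
        simp only [mul_assoc]
    _ = 0 := by rw [F.ranges_orthogonal e f h, mul_zero, zero_mul]

lemma p_source_mul_S (e : E.Edge) : F.p (E.s e) * F.S e = F.S e := by
  rw [← F.partialIsometry e, ← mul_assoc, F.S_mul_star_S_le]

/-- The ⋆-homomorphism `ℂ^s → B`, `c ↦ ∑ c(v) p_v`, for a finite set `s` of vertices. -/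
def finiteHom (s : Finset E.Vertex) : (s → ℂ) →⋆ₙₐ[ℂ] B where
  toFun c := ∑ v, c v • F.p v
  map_smul' a c := by simp [Finset.smul_sum, mul_smul]
  map_zero' := by simp
  map_add' c d := by simp [add_smul, Finset.sum_add_distrib]
  map_mul' c d := by
    classical
    simp only [Finset.sum_mul_sum, smul_mul_smul_comm, p_mul_p, Pi.mul_apply]
    refine Finset.sum_congr rfl fun v _ => ?_
    rw [Finset.sum_eq_single v]
    · simp
    · intro w _ hw
      rw [if_neg (fun h => hw (Subtype.ext h.symm)), smul_zero]
    · simp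
  map_star' c := by simp [star_sum, star_smul, star_p]

/-- The ⋆-homomorphism `finiteHom` on `ℂ^s` with the sup norm is contractive, which bounds the left
side by the maximum of `|f(v)|` over `s`. Each such `f(v)` is a value of the function on the right.
The estimate yields both convergence of `∑ f(v) p_v` and contractivity of the limit. -/
lemma norm_sum_p_le (f : C₀(E.Vertex, ℂ)) (s : Finset E.Vertex) :
    ‖∑ v ∈ s, f v • F.p v‖ ≤ ‖∑ v ∈ s, f v • E.vertexDelta v‖ := by
  classical
  have h := NonUnitalStarAlgHom.norm_apply_le (F.finiteHom s) (fun v : s => f v)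
  have h1 : F.finiteHom s (fun v : s => f v) = ∑ v ∈ s, f v • F.p v :=
    Finset.sum_coe_sort s fun v => f v • F.p v
  rw [h1] at h
  refine h.trans ((pi_norm_le_iff_of_nonneg (norm_nonneg _)).mpr fun v => ?_)
  have h2 : f v = (∑ v ∈ s, f v • E.vertexDelta v) (v : E.Vertex) := by
    rw [c0_sum_apply]
    simp [vertexDelta_apply]
  rw [h2]
  exact norm_apply_le_norm _ _

/-- The Cauchy criterion is inherited from the series `∑ f(v) δ_v` in `C₀(E⁰)`; absolute convergence
may fail. -/
lemma summable_smul_p (f : C₀(E.Vertex, ℂ)) : Summable fun v => f v • F.p v := by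
  have h := (hasSum_vertexDelta f).summable
  rw [summable_iff_vanishing_norm] at h ⊢
  intro ε hε
  obtain ⟨s, hs⟩ := h ε hε
  exact ⟨s, fun t ht => (F.norm_sum_p_le f t).trans_lt (hs t ht)⟩

lemma norm_tsum_smul_p_le (f : C₀(E.Vertex, ℂ)) : ‖∑' v, f v • F.p v‖ ≤ ‖f‖ :=
  le_of_tendsto_of_tendsto (F.summable_smul_p f).hasSum.norm (hasSum_vertexDelta f).norm
    (Filter.Eventually.of_forall fun s => F.norm_sum_p_le f s)

/-- The bounded linear map `f ↦ ∑ f(v) p_v`. -/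
def πL : C₀(E.Vertex, ℂ) →L[ℂ] B :=
  LinearMap.mkContinuous
    { toFun := fun f => ∑' v, f v • F.p v
      map_add' := fun f g => by
        rw [← (F.summable_smul_p f).tsum_add (F.summable_smul_p g)]
        simp [add_smul]
      map_smul' := fun c f => by
        rw [RingHom.id_apply, ← (F.summable_smul_p f).tsum_const_smul]
        simp [mul_smul] } 1 fun f => by rw [one_mul]; exact F.norm_tsum_smul_p_le f

lemma πL_vertexDelta (v : E.Vertex) : F.πL (E.vertexDelta v) = F.p v := by
  classical
  refine (tsum_eq_single v fun w hw => ?_).trans ?_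
  · rw [vertexDelta_of_ne hw, zero_smul]
  · rw [vertexDelta_self, one_smul]

/-- Both sides are bounded and linear in each variable, so point masses suffice: first in the second
factor with `δ_v` fixed on the left, then in the first factor. There it is orthogonality of the
`p_v`. -/
lemma πL_mul (f g : C₀(E.Vertex, ℂ)) : F.πL (f * g) = F.πL f * F.πL g := by
  have h1 : ∀ v g, F.πL (E.vertexDelta v * g) = F.p v * F.πL g := fun v g => by
    have h : F.πL ∘L ContinuousLinearMap.mul ℂ _ (E.vertexDelta v) =
        ContinuousLinearMap.mul ℂ _ (F.p v) ∘L F.πL := by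
      classical
      refine clm_ext_vertexDelta fun w => ?_
      simp only [ContinuousLinearMap.comp_apply, ContinuousLinearMap.mul_apply', πL_vertexDelta,
        p_mul_p]
      split_ifs with hvw
      · rw [hvw, vertexDelta_mul_self, πL_vertexDelta]
      · rw [vertexDelta_mul_of_ne hvw, map_zero]
    exact DFunLike.congr_fun h g
  have h : F.πL ∘L (ContinuousLinearMap.mul ℂ _).flip g =
      (ContinuousLinearMap.mul ℂ _).flip (F.πL g) ∘L F.πL := by
    refine clm_ext_vertexDelta fun w => ?_
    simp only [ContinuousLinearMap.comp_apply, ContinuousLinearMap.flip_apply,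
      ContinuousLinearMap.mul_apply', πL_vertexDelta, h1]
  exact DFunLike.congr_fun h f

lemma πL_star (f : C₀(E.Vertex, ℂ)) : F.πL (star f) = star (F.πL f) := by
  change ∑' v, star (f v) • F.p v = star (∑' v, f v • F.p v)
  rw [tsum_star]
  simp only [star_smul, star_p]

/-- The ⋆-homomorphism `C₀(E⁰) → B` with `δ_v ↦ p_v`. -/
def πHom : C₀(E.Vertex, ℂ) →⋆ₙₐ[ℂ] B where
  toFun := F.πL
  map_smul' c f := map_smul F.πL c f
  map_zero' := map_zero F.πL
  map_add' := map_add F.πL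
  map_mul' := F.πL_mul
  map_star' := F.πL_star

/-- The linear map `C_c(E¹) → B` with `δ_e ↦ S_e`. -/
def tPre : E.Cc →ₗ[ℂ] B := Finsupp.linearCombination ℂ (α := E.Edge) F.S

lemma tPre_apply (ξ : E.Cc) : F.tPre ξ = ∑ e ∈ ξ.support, ξ e • F.S e :=
  Finsupp.linearCombination_apply (α := E.Edge) ℂ ξ

lemma tPre_apply_of_subset (ξ : E.Cc) (s : Finset E.Edge) (hs : ξ.support ⊆ s) :
    F.tPre ξ = ∑ e ∈ s, ξ e • F.S e := by
  rw [tPre_apply]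
  refine Finset.sum_subset hs fun e _ he => ?_
  rw [Cc.mem_support, not_not] at he
  rw [he, zero_smul]

lemma tPre_single (e : E.Edge) : F.tPre (Cc.single e) = F.S e :=
  (Finsupp.linearCombination_single ℂ (1 : ℂ) e).trans (one_smul _ _)

lemma star_S_mul_tPre (e : E.Edge) (η : E.Cc) :
    star (F.S e) * F.tPre η = F.πL (Cc.ip (Cc.single e) η) := by
  classical
  rw [Cc.ip_single_left, map_smul, πL_vertexDelta,
    -- Inserting `e` puts the index `e` in the sum even when `η(e) = 0`; it is the only term that
    -- survives.
    F.tPre_apply_of_subset η (insert e η.support) (Finset.subset_insert _ _), Finset.mul_sum,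
    Finset.sum_eq_single e]
  · rw [mul_smul_comm, F.star_S_mul_S]
  · intro f _ hf
    rw [mul_smul_comm, F.star_S_mul_S_of_ne (Ne.symm hf), smul_zero]
  · simp

/-- Both sides are conjugate-linear in `ξ`, so the case `ξ = δ_e` is enough. -/
lemma star_tPre_mul_tPre (ξ η : E.Cc) : star (F.tPre ξ) * F.tPre η = F.πL (Cc.ip ξ η) := by
  have hadd : ∀ f g : E.Cc, star (F.tPre f) * F.tPre η = F.πL (Cc.ip f η) →
      star (F.tPre g) * F.tPre η = F.πL (Cc.ip g η) →
      star (F.tPre (f + g)) * F.tPre η = F.πL (Cc.ip (f + g) η) := fun f g hf hg => by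
    rw [Cc.ip_add_left, map_add, map_add, star_add, add_mul, ← hf, ← hg]
  induction ξ using Finsupp.induction_linear with
  | zero =>
    change star (F.tPre (0 : E.Cc)) * F.tPre η = F.πL (Cc.ip (0 : E.Cc) η)
    have h : Cc.ip (0 : E.Cc) η = 0 := by simpa using Cc.ip_smul_left 0 (0 : E.Cc) η
    rw [h, map_zero, map_zero, star_zero, zero_mul]
  | add f g hf hg => exact hadd f g hf hg
  | single e c =>
    have h : (Finsupp.single e c : E.Cc) = c • Cc.single e := by
      change _ = c • Finsupp.single e (1 : ℂ)
      rw [Finsupp.smul_single, smul_eq_mul, mul_one]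
    rw [h, Cc.ip_smul_left, map_smul, map_smul, star_smul, smul_mul_assoc, tPre_single,
      star_S_mul_tPre]

/-- By the C⋆-identity `‖t(ξ)‖² = ‖π(⟨ξ, ξ⟩)‖`, and `π` is contractive. This is what extends `t` to
the completion. -/
lemma norm_tPre_le (ξ : E.Cc) : ‖F.tPre ξ‖ ≤ ‖ξ‖ := by
  refine (sq_le_sq₀ (norm_nonneg _) (norm_nonneg _)).mp ?_
  rw [sq, ← CStarRing.norm_star_mul_self, star_tPre_mul_tPre, Cc.norm_def,
    Real.sq_sqrt (norm_nonneg _)]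
  exact F.norm_tsum_smul_p_le _

/-- The bounded linear map `X(E) → B` with `δ_e ↦ S_e`. -/
def tL : E.graphModule →L[ℂ] B :=
  (F.tPre.mkContinuous 1 fun ξ => by rw [one_mul]; exact F.norm_tPre_le ξ).extend
    UniformSpace.Completion.toComplL

lemma tL_coe (ξ : E.Cc) : F.tL (ξ : E.graphModule) = F.tPre ξ :=
  ContinuousLinearMap.extend_eq _ (UniformSpace.Completion.denseRange_coe (α := E.Cc))
    (UniformSpace.Completion.isUniformInducing_coe E.Cc) ξ

lemma tL_edgeDelta (e : E.Edge) : F.tL (E.edgeDelta e) = F.S e :=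
  (F.tL_coe _).trans (F.tPre_single e)

lemma star_tL_mul_tL (x y : E.graphModule) : star (F.tL x) * F.tL y = F.πL (gip x y) := by
  induction x, y using UniformSpace.Completion.induction_on₂ with
  | hp =>
    exact isClosed_eq (((F.tL.continuous.comp continuous_fst).star).mul
      (F.tL.continuous.comp continuous_snd)) (F.πL.continuous.comp continuous_gip)
  | ih ξ η => rw [tL_coe, tL_coe, gip_coe, star_tPre_mul_tPre]

lemma πL_mul_tL (f : C₀(E.Vertex, ℂ)) (x : E.graphModule) : F.πL f * F.tL x = F.tL (φ f x) := by
  have h : ContinuousLinearMap.mul ℂ _ (F.πL f) ∘L F.tL = F.tL ∘L φ f := by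
    refine clm_ext_edgeDelta fun e => ?_
    simp only [ContinuousLinearMap.comp_apply, ContinuousLinearMap.mul_apply', φ_edgeDelta,
      map_smul, tL_edgeDelta]
    -- The source projection is inserted through `S_e = p_{s(e)} S_e`, after which `f δ_{s(e)} =
    -- f(s(e)) δ_{s(e)}` produces the scalar.
    rw [← F.p_source_mul_S e, ← mul_assoc, ← πL_vertexDelta, ← πL_mul, mul_vertexDelta, map_smul,
      smul_mul_assoc]
  exact DFunLike.congr_fun h x

/-- The representation of `X(E)` with `π(δ_v) = p_v` and `t(δ_e) = S_e`. -/
def toCorrRep : CorrRep C₀(E.Vertex, ℂ) E.graphModule B where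
  π := F.πHom
  t := F.tL.toLinearMap
  star_t_mul_t := F.star_tL_mul_tL
  π_mul_t := F.πL_mul_tL

lemma toCorrRep_π_vertexDelta (v : E.Vertex) : F.toCorrRep.π (E.vertexDelta v) = F.p v :=
  F.πL_vertexDelta v

lemma toCorrRep_t_edgeDelta (e : E.Edge) : F.toCorrRep.t (E.edgeDelta e) = F.S e :=
  F.tL_edgeDelta e

end CKFamily

/-- A representation `(π, t)` of `X(E)` satisfies `ψ_t(φ(δ_v)) = ∑_{s(e) = v} t(δ_e) t(δ_e)⋆` if `v`
emits finitely many edges. -/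
lemma ψ_φ_vertexDelta {B : Type w} [NonUnitalCStarAlgebra B]
    (ρ : CorrRep C₀(E.Vertex, ℂ) E.graphModule B) (v : E.Vertex) (h : (E.s ⁻¹' {v}).Finite) :
    ρ.ψ ⟨φ (E.vertexDelta v), φ_vertexDelta_mem_compacts v h⟩ =
      ∑ e ∈ h.toFinset, ρ.t (E.edgeDelta e) * star (ρ.t (E.edgeDelta e)) := by
  have h1 : (⟨φ (E.vertexDelta v), φ_vertexDelta_mem_compacts v h⟩ :
      compacts C₀(E.Vertex, ℂ) E.graphModule) = ∑ e ∈ h.toFinset,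
        ⟨theta C₀(E.Vertex, ℂ) (E.edgeDelta e) (E.edgeDelta e), theta_mem_compacts _ _ _⟩ := by
    ext1
    rw [AddSubmonoidClass.coe_finsetSum]
    exact φ_vertexDelta v h
  rw [h1, map_sum]
  exact Finset.sum_congr rfl fun e _ => ρ.ψ_theta _ _

/-- Contractivity of `π` carries the expansion of `f` over; in particular `π` is determined by the
`π(δ_v)`. -/
lemma hasSum_π {B : Type w} [NonUnitalCStarAlgebra B]
    (ρ : CorrRep C₀(E.Vertex, ℂ) E.graphModule B) (f : C₀(E.Vertex, ℂ)) :
    HasSum (fun v => f v • ρ.π (E.vertexDelta v)) (ρ.π f) := by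
  have h := (hasSum_vertexDelta f).map ρ.π (AddMonoidHomClass.continuous_of_bound ρ.π 1
    fun a => by rw [one_mul]; exact ρ.norm_π_le a)
  simpa only [Function.comp_def, map_smul] using h

/-- For `f ∈ J` both `π(f)` and `ψ_t(φ(f))` are sums over the vertices. Terms with `f(v) = 0`
vanish, and at the remaining vertices, all regular, the terms agree by the Cuntz–Krieger relation.
-/
lemma CKFamily.toCorrRep_isCovariant {B : Type w} [NonUnitalCStarAlgebra B] (F : E.CKFamily B) :
    F.toCorrRep.IsCovariant := by
  intro f hf
  have hreg := (mem_idealJ_iff f).mp hf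
  -- The scalar `f(v)` is needed here: `φ(δ_v)` itself need not be compact when `v` is not regular.
  have hmem : ∀ v, f v • (φ (E.vertexDelta v) : E.graphModule →L[ℂ] E.graphModule) ∈
      compacts C₀(E.Vertex, ℂ) E.graphModule := fun v => by
    by_cases hv : f v = 0
    · rw [hv, zero_smul]; exact Submodule.zero_mem _
    · exact Submodule.smul_mem _ _ (φ_vertexDelta_mem_compacts v (hreg v hv).2)
  have h1 : HasSum (fun v => (⟨_, hmem v⟩ : compacts C₀(E.Vertex, ℂ) E.graphModule))
      ⟨φ f, hf.1⟩ := by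
    have h := (hasSum_vertexDelta f).mapL E.φL
    simp only [map_smul, φL_apply] at h
    -- `ψ_t` is defined only on `K(X)`, so convergence has to be moved from the bounded operators
    -- into that subspace.
    refine (Topology.IsInducing.subtypeVal.hasSum_iff
      (g := (compacts C₀(E.Vertex, ℂ) E.graphModule).subtype) _ _).mp h
  have h2 := h1.mapL F.toCorrRep.ψ
  refine (hasSum_π F.toCorrRep f).unique ?_
  convert h2 using 2 with v
  by_cases hv : f v = 0
  · have h0 : (⟨_, hmem v⟩ : compacts C₀(E.Vertex, ℂ) E.graphModule) = 0 := by
      ext1; simp [hv]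
    rw [h0, hv, zero_smul, map_zero]
  · have hs : (⟨_, hmem v⟩ : compacts C₀(E.Vertex, ℂ) E.graphModule) =
      f v • ⟨_, φ_vertexDelta_mem_compacts v (hreg v hv).2⟩ := rfl
    rw [hs, map_smul, ψ_φ_vertexDelta _ v (hreg v hv).2, F.toCorrRep_π_vertexDelta,
      F.p_eq_sum v (hreg v hv)]
    simp only [toCorrRep_t_edgeDelta]

/-! ### Cuntz–Krieger families from covariant representations -/

/-- The Cuntz–Krieger family `p_v = π(δ_v)`, `S_e = t(δ_e)` of a covariant representation. -/
def ckFamilyOfCovariant {B : Type w} [NonUnitalCStarAlgebra B]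
    (ρ : CorrRep C₀(E.Vertex, ℂ) E.graphModule B) (hρ : ρ.IsCovariant) : E.CKFamily B where
  p v := ρ.π (E.vertexDelta v)
  S e := ρ.t (E.edgeDelta e)
  isStarProjection_p v :=
    ⟨by rw [IsIdempotentElem, ← map_mul, vertexDelta_mul_self],
      by rw [IsSelfAdjoint, ← map_star, star_vertexDelta]⟩
  p_orthogonal v w h := by rw [← map_mul, vertexDelta_mul_of_ne h, map_zero]
  partialIsometry e := by
    rw [ρ.mul_t_theta, theta_apply, ip_edgeDelta_self, ract_edgeDelta, vertexDelta_self, one_smul]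
  ranges_orthogonal e f h := by
    rw [mul_assoc, ← mul_assoc (star _), ρ.star_t_mul_t, ip_edgeDelta_of_ne h, map_zero, zero_mul,
      mul_zero]
  star_S_mul_S e := by rw [ρ.star_t_mul_t, ip_edgeDelta_self]
  S_mul_star_S_le e := by
    rw [← mul_assoc, ρ.π_mul_t, φ_edgeDelta, vertexDelta_self, one_smul]
  p_eq_sum v h := by
    -- The point mass at a regular vertex lies in `J`, so Condition `(*)` applies to it.
    have hJ : E.vertexDelta v ∈ idealJ C₀(E.Vertex, ℂ) E.graphModule :=
      (mem_idealJ_iff _).mpr fun w hw => by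
        by_cases hwv : w = v
        · rwa [hwv]
        · exact absurd (vertexDelta_of_ne hwv) hw
    rw [hρ _ hJ]
    exact ψ_φ_vertexDelta ρ v h.2

end DirectedGraph

/-! ### Generated C⋆-algebras and direct products -/

lemma cstarGen_le {B : Type*} [NonUnitalCStarAlgebra B] {S : Set B}
    {T : NonUnitalStarSubalgebra ℂ B} (hT : IsClosed (T : Set B)) (h : S ⊆ T) : cstarGen S ≤ T :=
  NonUnitalStarSubalgebra.topologicalClosure_minimal _ (NonUnitalStarAlgebra.adjoin_le h) hT

lemma NonUnitalStarAlgHom.continuous_of_cstar {B C : Type*} [NonUnitalCStarAlgebra B]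
    [NonUnitalCStarAlgebra C] (Ψ : B →⋆ₙₐ[ℂ] C) : Continuous Ψ :=
  AddMonoidHomClass.continuous_of_bound Ψ 1 fun a => by
    rw [one_mul]; exact NonUnitalStarAlgHom.norm_apply_le Ψ a

lemma map_mem_of_mem_cstarGen {B C : Type*} [NonUnitalCStarAlgebra B] [NonUnitalCStarAlgebra C]
    (Ψ : B →⋆ₙₐ[ℂ] C) {S : Set B} {T : NonUnitalStarSubalgebra ℂ C} (hT : IsClosed (T : Set C))
    (h : ∀ x ∈ S, Ψ x ∈ T) {x : B} (hx : x ∈ cstarGen S) : Ψ x ∈ T :=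
  cstarGen_le (T := T.comap Ψ) (hT.preimage Ψ.continuous_of_cstar) h hx

/-- The equalizer of two ⋆-homomorphisms is a closed ⋆-subalgebra, by their automatic continuity. -/
lemma eqOn_cstarGen {B C : Type*} [NonUnitalCStarAlgebra B] [NonUnitalCStarAlgebra C]
    (Ψ₁ Ψ₂ : B →⋆ₙₐ[ℂ] C) {S : Set B} (h : ∀ x ∈ S, Ψ₁ x = Ψ₂ x) {x : B} (hx : x ∈ cstarGen S) :
    Ψ₁ x = Ψ₂ x :=
  cstarGen_le (T := NonUnitalStarAlgHom.equalizer Ψ₁ Ψ₂)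
    (isClosed_eq Ψ₁.continuous_of_cstar Ψ₂.continuous_of_cstar) h hx

/-- The ⋆-homomorphism between `ℓ^∞`-direct products induced by a map of index sets and
⋆-homomorphisms between the corresponding factors. -/
def lpInftyMap {ι κ : Type*} {A : ι → Type*} {B : κ → Type*} [∀ i, NonUnitalCStarAlgebra (A i)]
    [∀ k, NonUnitalCStarAlgebra (B k)] (g : κ → ι) (h : ∀ k, A (g k) →⋆ₙₐ[ℂ] B k) :
    lp A ∞ →⋆ₙₐ[ℂ] lp B ∞ where
  toFun x := ⟨fun k => h k (x (g k)), memℓp_infty ⟨‖x‖, by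
    rintro _ ⟨k, rfl⟩
    exact (NonUnitalStarAlgHom.norm_apply_le (h k) _).trans
      (lp.norm_apply_le_norm ENNReal.top_ne_zero x (g k))⟩⟩
  map_smul' c x := by ext k; exact map_smul (h k) c (x (g k))
  map_zero' := by ext k; exact map_zero (h k)
  map_add' x y := by ext k; exact map_add (h k) (x (g k)) (y (g k))
  map_mul' x y := by ext k; exact map_mul (h k) (x (g k)) (y (g k))
  map_star' x := by ext k; exact map_star (h k) (x (g k))

/-- ⋆-homomorphisms that restrict to mutually inverse maps between two ⋆-subalgebras yield a
⋆-isomorphism between these. -/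
def NonUnitalStarSubalgebra.equivOfInverse {B C : Type*} [NonUnitalCStarAlgebra B]
    [NonUnitalCStarAlgebra C] (S : NonUnitalStarSubalgebra ℂ B) (T : NonUnitalStarSubalgebra ℂ C)
    (Ψ : B →⋆ₙₐ[ℂ] C) (Θ : C →⋆ₙₐ[ℂ] B) (hΨ : ∀ x ∈ S, Ψ x ∈ T) (hΘ : ∀ y ∈ T, Θ y ∈ S)
    (h₁ : ∀ x ∈ S, Θ (Ψ x) = x) (h₂ : ∀ y ∈ T, Ψ (Θ y) = y) : S ≃⋆ₐ[ℂ] T where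
  toFun x := ⟨Ψ x, hΨ x x.2⟩
  invFun y := ⟨Θ y, hΘ y y.2⟩
  left_inv x := Subtype.ext (h₁ x x.2)
  right_inv y := Subtype.ext (h₂ y y.2)
  map_mul' x y := Subtype.ext (map_mul Ψ (x : B) (y : B))
  map_add' x y := Subtype.ext (map_add Ψ (x : B) (y : B))
  map_star' x := Subtype.ext (map_star Ψ (x : B))
  map_smul' c x := Subtype.ext (map_smul Ψ c (x : B))

/-! ### The isomorphism of `C⋆(E)` with `O_{X(E)}` -/

namespace DirectedGraph

variable {E : DirectedGraph.{u, v}}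

lemma rep_π_eq_of_vertexDelta {B : Type w} [NonUnitalCStarAlgebra B]
    (ρ σ : CorrRep C₀(E.Vertex, ℂ) E.graphModule B)
    (h : ∀ v, ρ.π (E.vertexDelta v) = σ.π (E.vertexDelta v)) (f : C₀(E.Vertex, ℂ)) :
    ρ.π f = σ.π f := by
  have h1 := hasSum_π ρ f
  simp only [h] at h1
  exact h1.unique (hasSum_π σ f)

lemma continuous_t {B : Type w} [NonUnitalCStarAlgebra B]
    (ρ : CorrRep C₀(E.Vertex, ℂ) E.graphModule B) : Continuous ρ.t :=
  AddMonoidHomClass.continuous_of_bound ρ.t 1 fun ξ => by rw [one_mul]; exact ρ.norm_t_le ξ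

lemma rep_t_eq_of_edgeDelta {B : Type w} [NonUnitalCStarAlgebra B]
    (ρ σ : CorrRep C₀(E.Vertex, ℂ) E.graphModule B)
    (h : ∀ e, ρ.t (E.edgeDelta e) = σ.t (E.edgeDelta e)) (ξ : E.graphModule) :
    ρ.t ξ = σ.t ξ :=
  DFunLike.congr_fun (clm_ext_edgeDelta (S := ⟨ρ.t, continuous_t ρ⟩) (T := ⟨σ.t, continuous_t σ⟩) h)
    ξ

variable (E)

/-- The covariant representation of `X(E)` given by a Cuntz–Krieger family. -/
def ckToCov (i : CKRep.{u, v} E) : CovRep.{u, v} C₀(E.Vertex, ℂ) E.graphModule :=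
  { B := i.B, ρ := i.F.toCorrRep, cov := i.F.toCorrRep_isCovariant }

/-- The Cuntz–Krieger family given by a covariant representation of `X(E)`. -/
def covToCK (j : CovRep.{u, v} C₀(E.Vertex, ℂ) E.graphModule) : CKRep.{u, v} E :=
  { B := j.B, F := ckFamilyOfCovariant j.ρ j.cov }

/-- The map from the product over all Cuntz–Krieger families to the product over all covariant
representations. -/
def ckProdToCovProd : E.ckProd →⋆ₙₐ[ℂ] covProd C₀(E.Vertex, ℂ) E.graphModule :=
  lpInftyMap E.covToCK fun j => NonUnitalStarAlgHom.id ℂ j.B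

/-- The map from the product over all covariant representations to the product over all
Cuntz–Krieger families. -/
def covProdToCKProd : covProd C₀(E.Vertex, ℂ) E.graphModule →⋆ₙₐ[ℂ] E.ckProd :=
  lpInftyMap E.ckToCov fun i => NonUnitalStarAlgHom.id ℂ i.B

lemma ckProdToCovProd_P (v : E.Vertex) :
    E.ckProdToCovProd (ckProdP v) = covProdπ (E.vertexDelta v) := rfl

lemma ckProdToCovProd_S (e : E.Edge) :
    E.ckProdToCovProd (ckProdS e) = covProdt (E.edgeDelta e) := rfl

lemma covProdToCKProd_π (v : E.Vertex) :
    E.covProdToCKProd (covProdπ (E.vertexDelta v)) = ckProdP v := by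
  ext i; exact i.F.toCorrRep_π_vertexDelta v

lemma covProdToCKProd_t (e : E.Edge) :
    E.covProdToCKProd (covProdt (E.edgeDelta e)) = ckProdS e := by
  ext i; exact i.F.toCorrRep_t_edgeDelta e

lemma ckProdToCovProd_mem {x : E.ckProd} (hx : x ∈ E.graphAlgebra) :
    E.ckProdToCovProd x ∈ algebraO C₀(E.Vertex, ℂ) E.graphModule := by
  refine map_mem_of_mem_cstarGen _ inferInstance ?_ hx
  rintro _ (⟨v, rfl⟩ | ⟨e, rfl⟩)
  · exact subset_cstarGen _ (Or.inl ⟨_, rfl⟩)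
  · exact subset_cstarGen _ (Or.inr ⟨_, rfl⟩)

/-- The ⋆-homomorphism from `O_{X(E)}` to the product over all Cuntz–Krieger families. -/
def algebraOToCKProd : algebraO C₀(E.Vertex, ℂ) E.graphModule →⋆ₙₐ[ℂ] E.ckProd :=
  E.covProdToCKProd.comp (NonUnitalStarSubalgebraClass.subtype _)

/-- The generators of `O_{X(E)}` are all `π(f)` and `t(ξ)`, while those of `C⋆(E)` come only from
point masses. Closedness of `C⋆(E)` and approximation by finite combinations of point masses bridge
the gap. -/
lemma covProdToCKProd_mem {y : covProd C₀(E.Vertex, ℂ) E.graphModule}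
    (hy : y ∈ algebraO C₀(E.Vertex, ℂ) E.graphModule) :
    E.covProdToCKProd y ∈ E.graphAlgebra := by
  have hcl : IsClosed (E.graphAlgebra : Set E.ckProd) := inferInstance
  have hc : Continuous E.algebraOToCKProd :=
    E.covProdToCKProd.continuous_of_cstar.comp continuous_subtype_val
  refine map_mem_of_mem_cstarGen _ hcl ?_ hy
  rintro _ (⟨f, rfl⟩ | ⟨ξ, rfl⟩)
  · have h := (hasSum_π (universalRep C₀(E.Vertex, ℂ) E.graphModule) f).map E.algebraOToCKProd hc
    refine hcl.mem_of_tendsto h (Filter.Eventually.of_forall fun s => ?_)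
    refine sum_mem fun v _ => ?_
    rw [Function.comp_apply, map_smul]
    refine SMulMemClass.smul_mem _ ?_
    exact (E.covProdToCKProd_π v).symm ▸ (E.genP v).2
  · have hct : Continuous fun ξ : E.graphModule => E.covProdToCKProd (covProdt ξ) :=
      hc.comp (continuous_t (universalRep C₀(E.Vertex, ℂ) E.graphModule))
    induction ξ using UniformSpace.Completion.induction_on with
    | hp => exact hcl.preimage hct
    | ih ξ =>
      change E.algebraOToCKProd ((universalRep C₀(E.Vertex, ℂ) E.graphModule).t ξ) ∈ E.graphAlgebra
      rw [coe_eq_sum, map_sum, map_sum]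
      refine sum_mem fun e _ => ?_
      rw [map_smul, map_smul]
      refine SMulMemClass.smul_mem _ ?_
      exact (E.covProdToCKProd_t e).symm ▸ (E.genS e).2

lemma covProdToCKProd_ckProdToCovProd {x : E.ckProd} (hx : x ∈ E.graphAlgebra) :
    E.covProdToCKProd (E.ckProdToCovProd x) = x := by
  refine eqOn_cstarGen (E.covProdToCKProd.comp E.ckProdToCovProd) (NonUnitalStarAlgHom.id ℂ _) ?_ hx
  rintro _ (⟨v, rfl⟩ | ⟨e, rfl⟩)
  · exact E.covProdToCKProd_π v
  · exact E.covProdToCKProd_t e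

/-- At each index `j`, passing to the Cuntz–Krieger family and back gives a representation that
agrees with the original on point masses, hence on every `f` and `ξ`. -/
lemma ckProdToCovProd_covProdToCKProd {y : covProd C₀(E.Vertex, ℂ) E.graphModule}
    (hy : y ∈ algebraO C₀(E.Vertex, ℂ) E.graphModule) :
    E.ckProdToCovProd (E.covProdToCKProd y) = y := by
  refine eqOn_cstarGen (E.ckProdToCovProd.comp E.covProdToCKProd) (NonUnitalStarAlgHom.id ℂ _) ?_ hy
  rintro _ (⟨f, rfl⟩ | ⟨ξ, rfl⟩)
  · ext j
    exact rep_π_eq_of_vertexDelta (ckFamilyOfCovariant j.ρ j.cov).toCorrRep j.ρ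
      (fun v => CKFamily.toCorrRep_π_vertexDelta _ v) f
  · ext j
    exact rep_t_eq_of_edgeDelta (ckFamilyOfCovariant j.ρ j.cov).toCorrRep j.ρ
      (fun e => CKFamily.toCorrRep_t_edgeDelta _ e) ξ

/-- The ⋆-isomorphism `C⋆(E) ≅ O_{X(E)}`. -/
def graphAlgebraEquiv : E.graphAlgebra ≃⋆ₐ[ℂ] algebraO C₀(E.Vertex, ℂ) E.graphModule :=
  NonUnitalStarSubalgebra.equivOfInverse _ _ E.ckProdToCovProd E.covProdToCKProd
    (fun _ => E.ckProdToCovProd_mem) (fun _ => E.covProdToCKProd_mem)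
    (fun _ => E.covProdToCKProd_ckProdToCovProd) (fun _ => E.ckProdToCovProd_covProdToCKProd)

end DirectedGraph

end

theorem mainTheorem3 (E : DirectedGraph.{u, v}) :
    idealJ C₀(E.Vertex, ℂ) E.graphModule = {f | ∀ v, f v ≠ 0 → E.IsRegular v} ∧
    ∃ Φ : E.graphAlgebra ≃⋆ₐ[ℂ] algebraO C₀(E.Vertex, ℂ) E.graphModule,
      (∀ v, Φ (E.universalFamily.p v) =
        (universalRep C₀(E.Vertex, ℂ) E.graphModule).π (E.vertexDelta v)) ∧
      (∀ e, Φ (E.universalFamily.S e) =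
        (universalRep C₀(E.Vertex, ℂ) E.graphModule).t (E.edgeDelta e)) := by
  refine ⟨Set.ext DirectedGraph.mem_idealJ_iff, E.graphAlgebraEquiv, fun v => ?_, fun e => ?_⟩
  · exact Subtype.ext (E.ckProdToCovProd_P v)
  · exact Subtype.ext (E.ckProdToCovProd_S e)
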